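/- Let $d\in\{2,3\}$, let $\Omega\subset\mathbb R^d$ be a polygonal/polyhedral domain with a conforming simplicial triangulation $\mathcal T_h$, and impose periodic boundary conditions: the boundary facets are matched in pairs by translations that carry one facet onto the other, with opposite outward normals, and matched facets are identified. Thus every facet $F$ of the set $\mathcal F_h$ of facets (matched facets counted once) is shared by two elements. For $k\ge 1$ let $V_h$ be the space of vector fields $v$ that are polynomials of degree at most $k$ on each element, have $\nabla\cdot v=0$ on each element, and whose normal component is continuous across every $F\in\mathcal F_h$. Let $(\cdot,\cdot)_{\mathcal T_h}$ be the $L^2$ inner product. Given $u_h,B_h\in V_h$, at each point of each facet $F$ call the two adjacent elements $K^-$ and $K^+$ in such a way that $u_h\cdot n^-\ge 0$, where $n^-$ is the outward unit normal of $K^-$ on $F$; at points where $u_h\cdot n=0$, where this leaves the labelling free, it is moreover chosen such that $B_h\cdot n^-\le 0$. For $\phi\in V_h$ let $\phi^\pm$ be the traces from $K^\pm$, and put $[\![\phi]\!]=\phi^+-\phi^-$ (which is tangential to $F$) and $\{\phi\}=\frac12(\phi^++\phi^-)$. Let $s_F=1$ where $(B_h\cdot n)(u_h\cdot n)>0$ and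 $s_F=-1$ elsewhere, and set $$\widehat u_h=\{u_h\}+\tfrac12 s_F[\![B_h]\!],\qquad \widehat B_h=\{B_h\}+\tfrac12 s_F[\![u_h]\!].$$ For $w,a,v\in V_h$ and a numerical flux $\widehat a$ on the facets put $$\mathcal C(w;a,\widehat a;v)=\sum_{T\in\mathcal T_h}\Big(-\int_T (w\otimes a):\nabla v\,dx+\int_{\partial T}(w\cdot n)\,(\widehat a\cdot v)\,ds\Big),\qquad (w\otimes a):\nabla v=\sum_{i,j}w_ia_j\,\partial_i v_j,$$ where $n$ is the outward unit normal of $T$ and $v$ on $\partial T$ is the trace from $T$, and define $\mathcal C_{uu}(u_h;u_h,v)=\mathcal C(u_h;u_h,u_h^-;v)$, $\mathcal C_{bb}(B_h;B_h,v)=\mathcal C(B_h;B_h,\widehat B_h;v)$, $\mathcal C_{ub}(u_h;B_h,\phi)=\mathcal C(u_h;B_h,B_h^-;\phi)$, $\mathcal C_{bu}(B_h;u_h,\phi)=\mathcal C(B_h;u_h,\widehat u_h;\phi)$. Then: 1. For all $u_h,B_h\in V_h$, $$\mathcal C_{uu}(u_h;u_h,u_h)=\tfrac12\sum_{F\in\mathcal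 F_h}\int_F|u_h\cdot n|\,[\![u_h]\!]^2\,ds\ge 0,\qquad \mathcal C_{ub}(u_h;B_h,B_h)=\tfrac12\sum_{F\in\mathcal F_h}\int_F|u_h\cdot n|\,[\![B_h]\!]^2\,ds\ge 0$$ (for these two, the labelling at points where $u_h\cdot n=0$ may be arbitrary), and $$\mathcal C_{bb}(B_h;B_h,u_h)+\mathcal C_{bu}(B_h;u_h,B_h)=-\tfrac12\sum_{F\in\mathcal F_h}\int_F|B_h\cdot n|\big([\![u_h]\!]^2+[\![B_h]\!]^2\big)\,ds\le 0.$$ 2. The semi-discrete upwind DG scheme for inviscid incompressible MHD is energy-stable: if $(u_h(t),B_h(t))\in V_h\times V_h$ is differentiable on a time interval $J$ and for every $t\in J$ $$(\partial_t u_h,v)_{\mathcal T_h}+\mathcal C_{uu}(u_h;u_h,v)-\mathcal C_{bb}(B_h;B_h,v)=0\quad\forall v\in V_h,$$ $$(\partial_t B_h,\phi)_{\mathcal T_h}+\mathcal C_{ub}(u_h;B_h,\phi)-\mathcal C_{bu}(B_h;u_h,\phi)=0\quad\forall \phi\in V_h,$$ then for every $t\in J$ (one-sided derivatives at end points of $J$)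 $$\frac{d}{dt}\Big((u_h,u_h)_{\mathcal T_h}+(B_h,B_h)_{\mathcal T_h}\Big)=-\sum_{F\in\mathcal F_h}\int_F\big(|u_h\cdot n|+|B_h\cdot n|\big)\big([\![u_h]\!]^2+[\![B_h]\!]^2\big)\,ds\le 0,$$ and the total energy $(u_h,u_h)_{\mathcal T_h}+(B_h,B_h)_{\mathcal T_h}$ does not increase in time on $J$. -/

import Mathlib

open MeasureTheory

noncomputable section

/-- The physical space `ℝ^d` with its Euclidean norm. -/
abbrev Space (d : ℕ) : Type := EuclideanSpace ℝ (Fin d)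

/-- The facet of the simplex `S` opposite to the vertex number `i`, as a set of points. -/
def simplexFacet {d : ℕ} (S : Affine.Simplex ℝ (Space d) d) (i : Fin (d + 1)) : Set (Space d) :=
  convexHull ℝ (S.points '' {i}ᶜ)

/-- The outward unit normal of the simplex `S` on the facet opposite to the vertex number `i`:
the normalized vector from that vertex to its orthogonal projection on the plane of the facet. -/
def outwardNormal {d : ℕ} [NeZero d] (S : Affine.Simplex ℝ (Space d) d) (i : Fin (d + 1)) :
    Space d :=
  (1 / ‖S.altitudeFoot i - S.points i‖) • (S.altitudeFoot i - S.points i)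

/-- A finite conforming simplicial triangulation of `Ω ⊆ ℝ^d` (with cells indexed by `ι`),
together with a periodic identification of its boundary facets.

A *side* is a pair (cell `T`, vertex number `i`); it stands for the facet of `T` opposite to its
vertex `i`, seen from `T`. Each side `h` has a mate, the same facet of the periodic mesh seen from
the element across it. For a facet that two cells of the triangulation share, the mate is the other
of these two sides. Boundary facets are matched in pairs by translations, the two outward
normals being opposite; `shift h` is the translation, from the facet of `h` to that of its mate. -/
structure PeriodicMesh (d : ℕ) [NeZero d] (Ω : Set (Space d)) (ι : Type*) [Fintype ι] where
  /-- the elements (nondegenerate closed simplices, given by their vertices) -/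
  cell : ι → Affine.Simplex ℝ (Space d) d
  /-- distinct elements have distinct vertex sets -/
  range_injective : ∀ S T : ι, Set.range (cell S).points = Set.range (cell T).points → S = T
  /-- two elements meet in a common face, spanned by their common vertices, or not at all -/
  conforming : ∀ S T : ι,
    convexHull ℝ (Set.range (cell S).points) ∩ convexHull ℝ (Set.range (cell T).points) =
      convexHull ℝ (Set.range (cell S).points ∩ Set.range (cell T).points)
  /-- the elements cover the domain -/
  cover : (⋃ T : ι, convexHull ℝ (Set.range (cell T).points)) = closure Ω
  mate : ι × Fin (d + 1) → ι × Fin (d + 1)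
  mate_mate : ∀ h, mate (mate h) = h
  /-- facets shared by two elements are interior facets -/
  mate_of_shared : ∀ h h' : ι × Fin (d + 1), h ≠ h' →
    simplexFacet (cell h.1) h.2 = simplexFacet (cell h'.1) h'.2 → mate h = h'
  shift : ι × Fin (d + 1) → Space d
  /-- the facets of a side and of its mate are translates of each other -/
  facet_mate : ∀ h, simplexFacet (cell (mate h).1) (mate h).2 =
    (fun x => x + shift h) '' simplexFacet (cell h.1) h.2
  /-- the two elements lie on opposite sides of the facet -/
  normal_mate : ∀ h, outwardNormal (cell (mate h).1) (mate h).2 = -outwardNormal (cell h.1) h.2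

/-- Piecewise polynomial vector fields: on each element, `d` polynomials in `d` variables. -/
abbrev PwPoly (d : ℕ) (ι : Type*) : Type _ := ι → Fin d → MvPolynomial (Fin d) ℝ

namespace PeriodicMesh

variable {d : ℕ} [NeZero d] {Ω : Set (Space d)} {ι : Type*} [Fintype ι] (M : PeriodicMesh d Ω ι)

/-- The (closed) element `T`. -/
def elem (T : ι) : Set (Space d) := convexHull ℝ (Set.range (M.cell T).points)

/-- The facet of a side. -/
def facet (h : ι × Fin (d + 1)) : Set (Space d) := simplexFacet (M.cell h.1) h.2

/-- The outward unit normal of the element of the side `h` on the facet of `h`. -/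
def normal (h : ι × Fin (d + 1)) : Space d := outwardNormal (M.cell h.1) h.2

/-- The value `v_T(x)`. -/
def val (v : PwPoly d ι) (T : ι) (x : Space d) : Space d :=
  WithLp.toLp 2 (fun j => MvPolynomial.eval (fun l => x l) (v T j))

/-- Trace of `v` at the point `x` of the facet of `h`, from the element of `h`. -/
def innerTrace (v : PwPoly d ι) (h : ι × Fin (d + 1)) (x : Space d) : Space d :=
  val v h.1 x

/-- Trace of `v` at the point `x` of the facet of `h`, from the element across the facet
(across the periodic boundary, the point `x` is identified with `x + shift h`). -/
def outerTrace (v : PwPoly d ι) (h : ι × Fin (d + 1)) (x : Space d) : Space d :=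
  val v (M.mate h).1 (x + M.shift h)

/-- The normal component `v · n` at the point `x` of the facet of `h`. -/
def normalComp (v : PwPoly d ι) (h : ι × Fin (d + 1)) (x : Space d) : ℝ :=
  inner ℝ (innerTrace v h x) (M.normal h)

/-- The globally divergence-free finite element space: piecewise polynomials of degree at most `k`
with vanishing normal jumps on all facets (periodic ones included) and with vanishing divergence
on each element. -/
def divFreeSpace (k : ℕ) : Set (PwPoly d ι) :=
  {v | (∀ T j, (v T j).totalDegree ≤ k) ∧
    (∀ h, ∀ x ∈ M.facet h,
      inner ℝ (innerTrace v h x - M.outerTrace v h x) (M.normal h) = 0) ∧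
    (∀ T, ∑ j, MvPolynomial.pderiv j (v T j) = 0)}

/-- The facets of the periodic mesh: a side and its mate form one facet. -/
def facetSetoid : Setoid (ι × Fin (d + 1)) where
  r a b := b = a ∨ b = M.mate a
  iseqv :=
    { refl := fun _ => Or.inl rfl
      symm := by
        rintro a b (rfl | rfl)
        · exact Or.inl rfl
        · exact Or.inr (M.mate_mate a).symm
      trans := by
        rintro a b c (rfl | rfl) (rfl | rfl)
        · exact Or.inl rfl
        · exact Or.inr rfl
        · exact Or.inr rfl
        · exact Or.inl (M.mate_mate a) }

/-- The set of facets of the periodic mesh. -/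
abbrev Facet : Type _ := Quotient M.facetSetoid

instance : Fintype M.Facet :=
  letI : Finite M.Facet := Quotient.finite M.facetSetoid
  Fintype.ofFinite M.Facet

/-- `∑_F ∫_F g ds` over all facets of the periodic mesh, each facet being counted once; `g` is
given on the sides, and is evaluated on one of the two sides of the facet. -/
def sumFacets (g : ι × Fin (d + 1) → Space d → ℝ) : ℝ :=
  ∑ F : M.Facet, ∫ x in M.facet F.out, g F.out x ∂(μHE[d - 1] : Measure (Space d))

/-- A labelling of the two elements at each facet as `K⁻` and `K⁺`, pointwise along the facet:
`minus h x` says that the element of `h` is `K⁻` at the point `x` of the facet of `h`. Exactly one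
of the two elements is `K⁻`, and the facet is an outflow facet of it: `u · n⁻ ≥ 0`. -/
def IsOutflowLabelling (u : PwPoly d ι) (minus : ι × Fin (d + 1) → Space d → Prop) : Prop :=
  ∀ h, ∀ x ∈ M.facet h,
    (minus h x ↔ ¬ minus (M.mate h) (x + M.shift h)) ∧
    (minus h x → 0 ≤ M.normalComp u h x)

/-- The condition `u · n⁻ ≥ 0` determines `K⁻` only where `u · n ≠ 0`. The tie where `u · n = 0`
is resolved by the magnetic field: `K⁻` is then taken such that `B · n⁻ ≤ 0`. -/
def ResolvesTies (u B : PwPoly d ι) (minus : ι × Fin (d + 1) → Space d → Prop) : Prop :=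
  ∀ h, ∀ x ∈ M.facet h, minus h x → M.normalComp u h x = 0 → M.normalComp B h x ≤ 0

open Classical in
/-- `v⁻`, the trace from `K⁻`. -/
def minusTrace (minus : ι × Fin (d + 1) → Space d → Prop) (v : PwPoly d ι)
    (h : ι × Fin (d + 1)) (x : Space d) : Space d :=
  if minus h x then innerTrace v h x else M.outerTrace v h x

open Classical in
/-- `v⁺`, the trace from `K⁺`. -/
def plusTrace (minus : ι × Fin (d + 1) → Space d → Prop) (v : PwPoly d ι)
    (h : ι × Fin (d + 1)) (x : Space d) : Space d :=
  if minus h x then M.outerTrace v h x else innerTrace v h x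

/-- The jump `v⁺ - v⁻`. -/
def jump (minus : ι × Fin (d + 1) → Space d → Prop) (v : PwPoly d ι)
    (h : ι × Fin (d + 1)) (x : Space d) : Space d :=
  M.plusTrace minus v h x - M.minusTrace minus v h x

/-- The average `(v⁺ + v⁻) / 2`. -/
def average (minus : ι × Fin (d + 1) → Space d → Prop) (v : PwPoly d ι)
    (h : ι × Fin (d + 1)) (x : Space d) : Space d :=
  (1 / 2 : ℝ) • (M.plusTrace minus v h x + M.minusTrace minus v h x)

open Classical in
/-- The sign `s_F`: `1` where `(B · n)(u · n) > 0`, and `-1` elsewhere. -/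
def upwindSign (u B : PwPoly d ι) (h : ι × Fin (d + 1)) (x : Space d) : ℝ :=
  if 0 < M.normalComp B h x * M.normalComp u h x then 1 else -1

/-- The numerical flux `û = {u} + s_F ⟦B⟧ / 2`. -/
def hatU (minus : ι × Fin (d + 1) → Space d → Prop) (u B : PwPoly d ι)
    (h : ι × Fin (d + 1)) (x : Space d) : Space d :=
  M.average minus u h x + (1 / 2 * M.upwindSign u B h x) • M.jump minus B h x

/-- The numerical flux `B̂ = {B} + s_F ⟦u⟧ / 2`. -/
def hatB (minus : ι × Fin (d + 1) → Space d → Prop) (u B : PwPoly d ι)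
    (h : ι × Fin (d + 1)) (x : Space d) : Space d :=
  M.average minus B h x + (1 / 2 * M.upwindSign u B h x) • M.jump minus u h x

/-- `(w ⊗ a) : ∇v = ∑ w_i a_j ∂_i v_j` on the element `T`. -/
def tensorGrad (w a v : PwPoly d ι) (T : ι) (x : Space d) : ℝ :=
  ∑ i, ∑ j, val w T x i * val a T x j *
    MvPolynomial.eval (fun l => x l) (MvPolynomial.pderiv i (v T j))

/-- The DG discretization of `∇ · (w ⊗ a)` with the numerical flux `ahat`, tested with `v`:
`∑_T ( - ∫_T (w ⊗ a) : ∇v dx + ∫_∂T (w · n) (ahat · v) ds )`. -/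
def convForm (w a : PwPoly d ι) (ahat : ι × Fin (d + 1) → Space d → Space d)
    (v : PwPoly d ι) : ℝ :=
  ∑ T : ι, (-(∫ x in M.elem T, tensorGrad w a v T x) +
    ∑ i : Fin (d + 1), ∫ x in M.facet (T, i),
      M.normalComp w (T, i) x * inner ℝ (ahat (T, i) x) (innerTrace v (T, i) x)
        ∂(μHE[d - 1] : Measure (Space d)))

/-- `C_uu(u; u, v)`. -/
def formUU (minus : ι × Fin (d + 1) → Space d → Prop) (u v : PwPoly d ι) : ℝ :=
  M.convForm u u (M.minusTrace minus u) v

/-- `C_bb(B; B, v)`. -/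
def formBB (minus : ι × Fin (d + 1) → Space d → Prop) (u B v : PwPoly d ι) : ℝ :=
  M.convForm B B (M.hatB minus u B) v

/-- `C_ub(u; B, φ)`. -/
def formUB (minus : ι × Fin (d + 1) → Space d → Prop) (u B φ : PwPoly d ι) : ℝ :=
  M.convForm u B (M.minusTrace minus B) φ

/-- `C_bu(B; u, φ)`. -/
def formBU (minus : ι × Fin (d + 1) → Space d → Prop) (u B φ : PwPoly d ι) : ℝ :=
  M.convForm B u (M.hatU minus u B) φ

/-- The `L²` inner product `(v, w)` over the mesh. -/
def l2Inner (v w : PwPoly d ι) : ℝ :=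
  ∑ T : ι, ∫ x in M.elem T, inner ℝ (val v T x) (val w T x)

/-- `du` is the time derivative of `u` at `t` (relative to the time interval `J`). All polynomials
in question have degree at most `k`, so this is differentiation in a finite-dimensional space,
that is, differentiation of all coefficients. -/
def HasTimeDerivWithinAt (u : ℝ → PwPoly d ι) (du : PwPoly d ι) (J : Set ℝ) (t : ℝ) : Prop :=
  ∀ T j m, HasDerivWithinAt (fun τ => MvPolynomial.coeff m (u τ T j))
    (MvPolynomial.coeff m (du T j)) J t

/-- `(u, B)` solves the semi-discrete scheme on the time interval `J`, where `minus t` is the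
labelling of the elements as `K⁻` and `K⁺` at the time `t`. -/
def IsSemidiscreteSolution (k : ℕ) (J : Set ℝ) (u B : ℝ → PwPoly d ι)
    (minus : ℝ → ι × Fin (d + 1) → Space d → Prop) : Prop :=
  ∀ t ∈ J,
    u t ∈ M.divFreeSpace k ∧ B t ∈ M.divFreeSpace k ∧
    M.IsOutflowLabelling (u t) (minus t) ∧ M.ResolvesTies (u t) (B t) (minus t) ∧
    ∃ du dB : PwPoly d ι,
      HasTimeDerivWithinAt u du J t ∧ HasTimeDerivWithinAt B dB J t ∧
      (∀ v ∈ M.divFreeSpace k,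
        M.l2Inner du v + M.formUU (minus t) (u t) v
          - M.formBB (minus t) (u t) (B t) v = 0) ∧
      (∀ φ ∈ M.divFreeSpace k,
        M.l2Inner dB φ + M.formUB (minus t) (u t) (B t) φ
          - M.formBU (minus t) (u t) (B t) φ = 0)

/-- `∑_F ∫_F (|u · n| + |B · n|) (⟦u⟧² + ⟦B⟧²) ds`. -/
def dissipation (minus : ι × Fin (d + 1) → Space d → Prop) (u B : PwPoly d ι) : ℝ :=
  M.sumFacets fun h x => (|M.normalComp u h x| + |M.normalComp B h x|) *
    (‖M.jump minus u h x‖ ^ 2 + ‖M.jump minus B h x‖ ^ 2)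

end PeriodicMesh

end

/-! The tested forms are evaluated by one identity. On an element with `div w = 0`, the divergence
theorem for `(a · b) w` gives `∫ (w ⊗ a) : ∇b + ∫ (w ⊗ b) : ∇a = ∫_∂T (w · n)(a · b)`. Hence in
`C(w; a, â; b) + C(w; b, b̂; a)` all volume integrals become facet terms. Seen from the two sides of
a facet, `w · n` changes sign and the two traces change places, so the central parts of the fluxes
cancel against these facet terms. Only the stabilizing parts, proportional to `|w · n|` times a
jump, survive (`convForm_add_convForm`).

Every flux of the scheme is of this kind (`IsStabilizedFlux`). The trace from `K⁻` is central minus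
half the outward jump where `u · n > 0`, which gives `ε = -1`. For `û` and `B̂` one needs `(B · n⁻)
s_F = |B · n|`, with `ε = 1`. Where `u · n⁻ > 0` this is the choice of `s_F`; where `u · n = 0` one
has `s_F = -1` and the tie rule `B · n⁻ ≤ 0` is exactly what is needed
(`normalComp_mul_upwindSign`). The magnetic coupling cross-stabilizes: the flux of `B` carries the
jump of `u` and conversely, so testing with `u` and `B` yields squares.

Energy stability follows by testing with `v = u_h`, `φ = B_h` and the product rule in the polynomial
coefficients.

The divergence theorem on a simplex, with Hausdorff measure on the facets, is proved by integrating
along an edge: the fundamental theorem of calculus leaves the two facets opposite to its ends, and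
the other facets contain the edge, so their normals are orthogonal to it
(`setIntegral_fderiv_edge`). Edges span, and the formula is linear in the direction. -/

noncomputable section

/-! ### Area formula for injective affine maps. -/

section AreaFormula

variable {U V : Type*} [NormedAddCommGroup U] [InnerProductSpace ℝ U] [FiniteDimensional ℝ U]
  [MeasurableSpace U] [BorelSpace U] [NormedAddCommGroup V] [InnerProductSpace ℝ V]
  [MeasurableSpace V] [BorelSpace V]

theorem measurableEmbedding_add_linearMap (q : V) (f : U →ₗ[ℝ] V) (hf : Function.Injective f) :
    MeasurableEmbedding fun z => q + f z := by
  have h1 : MeasurableEmbedding f :=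
    (f.isClosedEmbedding_of_injective (LinearMap.ker_eq_bot.2 hf)).measurableEmbedding
  exact (Homeomorph.addLeft q).measurableEmbedding.comp h1

/-- The Euclidean Hausdorff measure of an affine image. -/
theorem euclideanHausdorffMeasure_affine_image (q : V) (f : U →ₗ[ℝ] V) (s : Set U) :
    (μHE[Module.finrank ℝ U] : Measure V) ((fun z => q + f z) '' s) =
      ENNReal.ofReal f.normDet * volume s := by
  rw [← f.euclideanHausdorffMeasure_image_eq_normDet_mul_volume s,
    ← (isometry_add_left q).euclideanHausdorffMeasure_image (f '' s), Set.image_image]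

/-- Change of variables for an injective affine map into a Euclidean space of larger dimension. -/
theorem setIntegral_affine_image (q : V) (f : U →ₗ[ℝ] V) (hf : Function.Injective f) (s : Set U)
    (g : V → ℝ) :
    ∫ x in (fun z => q + f z) '' s, g x ∂(μHE[Module.finrank ℝ U] : Measure V) =
      f.normDet * ∫ z in s, g (q + f z) := by
  have he := measurableEmbedding_add_linearMap q f hf
  -- Equality as measures on the whole affine range lets both `s` and `g` be arbitrary, with no
  -- measurability assumption.
  have hmap : ENNReal.ofReal f.normDet • Measure.map (fun z => q + f z) volume =
      (μHE[Module.finrank ℝ U] : Measure V).restrict (Set.range fun z => q + f z) := by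
    ext t ht
    rw [Measure.smul_apply, he.map_apply, smul_eq_mul,
      ← euclideanHausdorffMeasure_affine_image q f, Set.image_preimage_eq_inter_range,
      Measure.restrict_apply ht]
  have h1 : (μHE[Module.finrank ℝ U] : Measure V).restrict ((fun z => q + f z) '' s) =
      (ENNReal.ofReal f.normDet • Measure.map (fun z => q + f z) volume).restrict
        ((fun z => q + f z) '' s) := by
    rw [hmap, Measure.restrict_restrict_of_subset (Set.image_subset_range _ _)]
  rw [h1, Measure.restrict_smul, integral_smul_measure, he.setIntegral_map,
    Set.preimage_image_eq _ he.injective, ENNReal.toReal_ofReal f.normDet_nonneg, smul_eq_mul]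

end AreaFormula

/-! ### Jacobian of a prism over a base: height times base. -/

section Prism

variable {F V : Type*} [NormedAddCommGroup F] [InnerProductSpace ℝ F]
  [NormedAddCommGroup V] [InnerProductSpace ℝ V]

/-- The linear map `(s, z) ↦ s e + L z`. -/
def prismMap (e : V) (L : F →ₗ[ℝ] V) : WithLp 2 (ℝ × F) →ₗ[ℝ] V :=
  ((LinearMap.toSpanSingleton ℝ V e).coprod L) ∘ₗ (WithLp.linearEquiv 2 ℝ (ℝ × F)).toLinearMap

@[simp]
theorem prismMap_apply (e : V) (L : F →ₗ[ℝ] V) (y : WithLp 2 (ℝ × F)) :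
    prismMap e L y = y.fst • e + L y.snd := by
  simp [prismMap]

variable [FiniteDimensional ℝ F]

/-- The Gram matrix is block diagonal, with block `1` for the unit normal. -/
theorem normDet_prismMap_unit_normal {n : V} (hn : ‖n‖ = 1) (L : F →ₗ[ℝ] V)
    (hL : ∀ z, inner ℝ n (L z) = 0) : (prismMap n L).normDet = L.normDet := by
  have h1 : ((prismMap n L).normDet) ^ 2 = L.normDet ^ 2 := by
    have b := stdOrthonormalBasis ℝ F
    have e1 := (prismMap n L).normDet_sq_eq_det_gram ((OrthonormalBasis.singleton Unit ℝ).prod b)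
    have e2 := L.normDet_sq_eq_det_gram b
    simp only [RCLike.ofReal_real_eq_id, id_eq] at e1 e2
    rw [e1, e2]
    have : (Matrix.gram ℝ fun x => prismMap n L (((OrthonormalBasis.singleton Unit ℝ).prod b) x)) =
        Matrix.fromBlocks 1 0 0 (Matrix.gram ℝ fun x => L (b x)) := by
      ext (i | i) (j | j)
      · simp [Matrix.gram_apply, hn]
      · simp [Matrix.gram_apply, hL]
      · simp [Matrix.gram_apply, real_inner_comm n, hL]
      · simp [Matrix.gram_apply]
    rw [this, Matrix.det_fromBlocks_zero₂₁]
    simp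
  exact (sq_eq_sq₀ (LinearMap.normDet_nonneg _) (LinearMap.normDet_nonneg _)).1 h1

/-- Cavalieri's principle: the oblique prism is the upright one after a shear and a scaling by `c`
of the first coordinate. That map `A` is block triangular with determinant `c`. -/
theorem normDet_prismMap {n e : V} (hn : ‖n‖ = 1) (L : F →ₗ[ℝ] V)
    (hL : ∀ z, inner ℝ n (L z) = 0) (c : ℝ) (z₀ : F) (he : e = c • n + L z₀) :
    (prismMap e L).normDet = |c| * L.normDet := by
  let A : WithLp 2 (ℝ × F) →ₗ[ℝ] WithLp 2 (ℝ × F) :=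
    prismMap (WithLp.toLp 2 (c, z₀))
      ((WithLp.linearEquiv 2 ℝ (ℝ × F)).symm.toLinearMap ∘ₗ LinearMap.inr ℝ ℝ F)
  have hA : prismMap e L = prismMap n L ∘ₗ A := by
    ext y
    simp [A, he, smul_smul, add_assoc]
  have hdet : LinearMap.det A = c := by
    have b := stdOrthonormalBasis ℝ F
    rw [← LinearMap.det_toMatrix (((OrthonormalBasis.singleton Unit ℝ).prod b).toBasis)]
    have : (LinearMap.toMatrix (((OrthonormalBasis.singleton Unit ℝ).prod b).toBasis)
        (((OrthonormalBasis.singleton Unit ℝ).prod b).toBasis) A) =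
        Matrix.fromBlocks (Matrix.of fun _ _ => c) 0 (Matrix.of fun i _ => b.repr z₀ i) 1 := by
      ext (i | i) (j | j)
      · simp [LinearMap.toMatrix_apply, OrthonormalBasis.repr_apply_apply, A]
      · simp [LinearMap.toMatrix_apply, OrthonormalBasis.repr_apply_apply, A]
      · simp [LinearMap.toMatrix_apply, OrthonormalBasis.repr_apply_apply, A]
      · simp [LinearMap.toMatrix_apply, OrthonormalBasis.repr_apply_apply, A,
          Matrix.one_apply, b.inner_eq_ite]
    rw [this, Matrix.det_fromBlocks_zero₁₂]
    simp
  rw [hA, LinearMap.normDet_comp_of_finrank_eq _ _ rfl, LinearMap.normDet_eq_abs_det, hdet,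
    normDet_prismMap_unit_normal hn L hL, mul_comm]

end Prism

/-! ### The reference simplex and integration along one coordinate. -/

section CornerSimplex

/-- The simplex spanned by the origin and the standard basis vectors. -/
def cornerSimplex (κ : Type*) [Fintype κ] : Set (κ → ℝ) :=
  {z | (∀ k, 0 ≤ z k) ∧ ∑ k, z k ≤ 1}

theorem convex_cornerSimplex (κ : Type*) [Fintype κ] : Convex ℝ (cornerSimplex κ) := by
  rintro x ⟨hx, hx'⟩ y ⟨hy, hy'⟩ a b ha hb hab
  refine ⟨fun k => ?_, ?_⟩
  · have := hx k
    have := hy k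
    simp only [Pi.add_apply, Pi.smul_apply, smul_eq_mul]
    positivity
  · simp only [Pi.add_apply, Pi.smul_apply, smul_eq_mul, Finset.sum_add_distrib, ← Finset.mul_sum]
    calc a * ∑ k, x k + b * ∑ k, y k ≤ a * 1 + b * 1 := by gcongr
      _ = 1 := by linarith

theorem isCompact_cornerSimplex (κ : Type*) [Fintype κ] : IsCompact (cornerSimplex κ) := by
  have h1 : cornerSimplex κ = Set.Icc 0 1 ∩ {z | ∑ k, z k ≤ 1} := by
    ext z
    constructor
    · rintro ⟨h, h'⟩
      exact ⟨⟨h, fun k => (Finset.single_le_sum (fun i _ => h i) (Finset.mem_univ k)).trans h'⟩, h'⟩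
    · rintro ⟨⟨h, -⟩, h'⟩
      exact ⟨h, h'⟩
  rw [h1]
  exact isCompact_Icc.inter_right (isClosed_le (by fun_prop) (by fun_prop))

theorem convexHull_insert_range {V κ : Type*} [Fintype κ] [AddCommGroup V] [Module ℝ V]
    (q : V) (r : κ → V) :
    convexHull ℝ (insert q (Set.range r)) =
      (fun z : κ → ℝ => q + ∑ k, z k • (r k - q)) '' cornerSimplex κ := by
  classical
  apply Set.Subset.antisymm
  · apply convexHull_min
    · rintro x (rfl | ⟨k, rfl⟩)
      · exact ⟨0, ⟨by simp, by simp⟩, by simp⟩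
      · refine ⟨Pi.single k 1, ⟨fun l => ?_, by simp⟩, by simp [Pi.single_apply]⟩
        by_cases h : l = k <;> simp [h]
    · let f : (κ → ℝ) →ₗ[ℝ] V := Fintype.linearCombination ℝ fun k => r k - q
      have : (fun z : κ → ℝ => q + ∑ k, z k • (r k - q)) = fun z => q + f z := by
        ext z
        simp [f, Fintype.linearCombination_apply]
      rw [this, ← Set.image_image (fun x => q + x)]
      exact ((convex_cornerSimplex κ).linear_image f).translate q
  · rintro _ ⟨z, ⟨hz, hz'⟩, rfl⟩
    -- A convex combination indexed by `Option κ`: the apex `q` takes the remaining weight `1 - ∑ k,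
    -- z k`.
    have h1 : q + ∑ k, z k • (r k - q) = ∑ o : Option κ,
        (o.elim (1 - ∑ k, z k) z : ℝ) • (o.elim q r : V) := by
      simp only [Fintype.sum_option, Option.elim_none, Option.elim_some, smul_sub,
        Finset.sum_sub_distrib, sub_smul, one_smul, Finset.sum_smul]
      abel
    simp only
    rw [h1]
    apply (convex_convexHull ℝ _).sum_mem
    · rintro (_ | k) -
      · simpa using hz'
      · exact hz k
    · simp [Fintype.sum_option]
    · rintro (_ | k) -
      · exact subset_convexHull ℝ _ (Set.mem_insert _ _)
      · exact subset_convexHull ℝ _ (Set.mem_insert_of_mem _ ⟨k, rfl⟩)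

/-- Integration along the first coordinate of a corner simplex. -/
theorem setIntegral_cornerSimplex_prod {κ : Type*} [Fintype κ] (G G' : ℝ → (κ → ℝ) → ℝ)
    (hG : ∀ s z, HasDerivAt (fun t => G t z) (G' s z) s)
    (hc : Continuous fun y : ℝ × (κ → ℝ) => G' y.1 y.2)
    (hcG : Continuous fun y : ℝ × (κ → ℝ) => G y.1 y.2) :
    ∫ y in {y : ℝ × (κ → ℝ) | 0 ≤ y.1 ∧ (∀ k, 0 ≤ y.2 k) ∧ y.1 + ∑ k, y.2 k ≤ 1}, G' y.1 y.2 =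
      (∫ z in cornerSimplex κ, G (1 - ∑ k, z k) z) - ∫ z in cornerSimplex κ, G 0 z := by
  set T := {y : ℝ × (κ → ℝ) | 0 ≤ y.1 ∧ (∀ k, 0 ≤ y.2 k) ∧ y.1 + ∑ k, y.2 k ≤ 1} with hT
  have hTclosed : IsClosed T := by
    simp only [hT, Set.ofPred_and, Set.ofPred_forall]
    exact (isClosed_le (by fun_prop) (by fun_prop)).inter
      ((isClosed_iInter fun k => isClosed_le (by fun_prop) (by fun_prop)).inter
        (isClosed_le (by fun_prop) (by fun_prop)))
  have hTcomp : IsCompact T := by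
    refine IsCompact.of_isClosed_subset
      ((isCompact_Icc (a := (0 : ℝ)) (b := 1)).prod (isCompact_cornerSimplex κ)) hTclosed ?_
    rintro ⟨s, z⟩ ⟨h1, h2, h3⟩
    have h4 : 0 ≤ ∑ k, z k := Finset.sum_nonneg fun k _ => h2 k
    simp only at h1 h2 h3
    exact ⟨⟨h1, by simp only; linarith⟩, h2, by simp only; linarith⟩
  have hcont := (isCompact_cornerSimplex κ)
  rw [← integral_sub
      (ContinuousOn.integrableOn_compact hcont (Continuous.continuousOn (by fun_prop)))
      (ContinuousOn.integrableOn_compact hcont (Continuous.continuousOn (by fun_prop))),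
    ← integral_indicator hTclosed.measurableSet, Measure.volume_eq_prod,
    integral_prod_symm, ← integral_indicator hcont.isClosed.measurableSet]
  -- The slice over `z` is the interval `[0, 1 - ∑ k, z k]` if `z` lies in the corner simplex, and
  -- is empty otherwise.
  · refine integral_congr_ae (Filter.Eventually.of_forall fun z => ?_)
    by_cases hz : z ∈ cornerSimplex κ
    · simp only [Set.indicator_of_mem hz]
      have h0 : 0 ≤ 1 - ∑ k, z k := sub_nonneg.2 hz.2
      rw [← intervalIntegral.integral_eq_sub_of_hasDerivAt (fun s _ => hG s z)
        (Continuous.intervalIntegrable (by fun_prop) _ _), intervalIntegral.integral_of_le h0,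
        ← integral_Icc_eq_integral_Ioc, ← integral_indicator measurableSet_Icc]
      congr 1
      ext s
      have : (s, z) ∈ T ↔ s ∈ Set.Icc 0 (1 - ∑ k, z k) := by
        simp only [hT, Set.mem_ofPred_eq, Set.mem_Icc]
        exact ⟨fun h => ⟨h.1, by linarith [h.2.2]⟩, fun h => ⟨h.1, hz.1, by linarith [h.2]⟩⟩
      simp only [Set.indicator_apply, this]
    · simp only [Set.indicator_of_notMem hz]
      have : ∀ s, (s, z) ∉ T := fun s h => hz ⟨h.2.1, by linarith [h.1, h.2.2]⟩
      simp [Set.indicator_of_notMem (this _)]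
  · rw [integrable_indicator_iff hTclosed.measurableSet]
    exact hc.continuousOn.integrableOn_compact hTcomp

end CornerSimplex

/-! ### Edges and outward normals of a simplex. -/

section SimplexGeometry

variable {d : ℕ} [NeZero d] (S : Affine.Simplex ℝ (Space d) d)

theorem height_eq_norm (j : Fin (d + 1)) : S.height j = ‖S.altitudeFoot j - S.points j‖ := by
  rw [Affine.Simplex.height, dist_comm, dist_eq_norm]

theorem norm_outwardNormal (j : Fin (d + 1)) : ‖outwardNormal S j‖ = 1 := by
  have h := S.height_pos j
  rw [height_eq_norm] at h
  rw [outwardNormal, norm_smul, Real.norm_of_nonneg (by positivity)]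
  field_simp

theorem inner_edge_outwardNormal {i j : Fin (d + 1)} (hij : i ≠ j) :
    inner ℝ (S.points j - S.points i) (outwardNormal S j) = -S.height j := by
  have h := S.inner_vsub_vsub_altitudeFoot_eq_height_sq hij.symm
  have hpos := S.height_pos j
  simp only [vsub_eq_sub] at h
  rw [outwardNormal, ← neg_sub (S.points j), smul_neg, inner_neg_right, real_inner_smul_right, h,
    norm_neg, norm_sub_rev, ← height_eq_norm]
  field_simp

theorem inner_outwardNormal_edge_eq_zero {i j k : Fin (d + 1)} (hi : i ≠ j) (hk : k ≠ j) :
    inner ℝ (outwardNormal S j) (S.points k - S.points i) = 0 := by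
  have h1 := inner_edge_outwardNormal S hi
  have h2 := inner_edge_outwardNormal S hk
  rw [real_inner_comm, ← sub_sub_sub_cancel_left _ _ (S.points j), inner_sub_left, h1, h2, sub_self]

end SimplexGeometry

/-! ### Parametrization of a simplex by edges; divergence theorem along an edge. -/

section EdgeFrame

variable {m : ℕ} (S : Affine.Simplex ℝ (Space (m + 1)) (m + 1))

/-- The vertices `ρ k` are those different from `i` and `j`. -/
structure IsEdgeFrame {m : ℕ} (i j : Fin (m + 2)) (ρ : Fin m → Fin (m + 2)) : Prop where
  ne : i ≠ j
  injective : Function.Injective ρ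
  range_eq : Set.range ρ = {i, j}ᶜ

theorem IsEdgeFrame.symm {i j : Fin (m + 2)} {ρ : Fin m → Fin (m + 2)} (h : IsEdgeFrame i j ρ) :
    IsEdgeFrame j i ρ :=
  ⟨h.ne.symm, h.injective, by rw [h.range_eq, Set.pair_comm]⟩

theorem IsEdgeFrame.ne_left {i j : Fin (m + 2)} {ρ : Fin m → Fin (m + 2)} (h : IsEdgeFrame i j ρ)
    (k : Fin m) : ρ k ≠ i := fun hk => by
  have : ρ k ∈ ({i, j} : Set (Fin (m + 2)))ᶜ := h.range_eq ▸ Set.mem_range_self k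
  exact this (Or.inl hk)

theorem exists_isEdgeFrame {i j : Fin (m + 2)} (hij : i ≠ j) : ∃ ρ, IsEdgeFrame i j ρ := by
  obtain ⟨j', rfl⟩ := Fin.exists_succAbove_eq hij.symm
  refine ⟨i.succAbove ∘ j'.succAbove, hij,
    Fin.succAbove_right_injective.comp Fin.succAbove_right_injective, ?_⟩
  rw [Set.range_comp, Fin.range_succAbove]
  ext k
  simp only [Set.mem_image, Set.mem_compl_iff, Set.mem_singleton_iff, Set.mem_insert_iff, not_or]
  constructor
  · rintro ⟨l, hl, rfl⟩
    exact ⟨Fin.succAbove_ne i l, fun h => hl (Fin.succAbove_right_injective h)⟩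
  · rintro ⟨h1, h2⟩
    obtain ⟨l, rfl⟩ := Fin.exists_succAbove_eq h1
    exact ⟨l, fun h => h2 (h ▸ rfl), rfl⟩

/-- The linear map sending the standard basis to the edges from the vertex `i` to the vertices
`ρ k`. -/
def edgeMap (i : Fin (m + 2)) (ρ : Fin m → Fin (m + 2)) :
    EuclideanSpace ℝ (Fin m) →ₗ[ℝ] Space (m + 1) :=
  Fintype.linearCombination ℝ (fun k => S.points (ρ k) - S.points i) ∘ₗ
    (WithLp.linearEquiv 2 ℝ (Fin m → ℝ)).toLinearMap

theorem edgeMap_apply (i : Fin (m + 2)) (ρ : Fin m → Fin (m + 2)) (z : EuclideanSpace ℝ (Fin m)) :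
    edgeMap S i ρ z = ∑ k, z k • (S.points (ρ k) - S.points i) := by
  simp [edgeMap, Fintype.linearCombination_apply]

variable {i j : Fin (m + 2)} {ρ : Fin m → Fin (m + 2)}

theorem edgeMap_injective (h : IsEdgeFrame i j ρ) : Function.Injective (edgeMap S i ρ) := by
  have h1 := (affineIndependent_iff_linearIndependent_vsub ℝ _ i).1 S.independent
  have h2 := h1.comp (fun k => ⟨ρ k, h.ne_left k⟩)
    (fun a b hab => h.injective (congrArg Subtype.val hab))
  have h3 := h2.fintypeLinearCombination_injective
  exact h3.comp (WithLp.linearEquiv 2 ℝ (Fin m → ℝ)).injective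

theorem inner_outwardNormal_edgeMap (h : IsEdgeFrame i j ρ) (z : EuclideanSpace ℝ (Fin m)) :
    inner ℝ (outwardNormal S j) (edgeMap S i ρ z) = 0 := by
  rw [edgeMap_apply, inner_sum]
  refine Finset.sum_eq_zero fun k _ => ?_
  rw [real_inner_smul_right, inner_outwardNormal_edge_eq_zero S h.ne (h.symm.ne_left k), mul_zero]

/-- The Jacobian of the parametrization of a simplex by its edges from the vertex `i`, in terms of
that of the facet opposite to `j`. -/
theorem normDet_prismMap_edgeMap (h : IsEdgeFrame i j ρ) :
    (prismMap (S.points j - S.points i) (edgeMap S i ρ)).normDet =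
      |inner ℝ (S.points j - S.points i) (outwardNormal S j)| * (edgeMap S i ρ).normDet := by
  set n := outwardNormal S j
  set e := S.points j - S.points i
  have hn : ‖n‖ = 1 := norm_outwardNormal S j
  have hn0 : n ≠ 0 := fun h0 => by simp [h0] at hn
  have hL := inner_outwardNormal_edgeMap S h
  -- The edges in the facet span its whole direction, by a dimension count. So the edge to `j`
  -- differs from its normal component by a vector of the facet, as the shear requires.
  have hrange : (edgeMap S i ρ).range = (ℝ ∙ n)ᗮ := by
    apply Submodule.eq_of_le_of_finrank_eq
    · rintro _ ⟨z, rfl⟩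
      exact (Submodule.mem_orthogonal_singleton_iff_inner_right).2 (hL z)
    · have : Fact (Module.finrank ℝ (Space (m + 1)) = m + 1) := ⟨by simp⟩
      rw [Submodule.finrank_orthogonal_span_singleton (n := m) hn0,
        LinearMap.finrank_range_of_inj (edgeMap_injective S h)]
      simp
  have hmem : e - (inner ℝ e n) • n ∈ (edgeMap S i ρ).range := by
    rw [hrange, Submodule.mem_orthogonal_singleton_iff_inner_right, inner_sub_right,
      real_inner_smul_right, real_inner_self_eq_norm_sq, hn, real_inner_comm]
    ring
  obtain ⟨z₀, hz₀⟩ := hmem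
  exact normDet_prismMap hn _ hL _ z₀ (by rw [hz₀]; abel)

theorem prismMap_edgeMap_injective (h : IsEdgeFrame i j ρ) :
    Function.Injective (prismMap (S.points j - S.points i) (edgeMap S i ρ)) := by
  rw [← LinearMap.ker_eq_bot]
  by_contra hker
  have h0 := LinearMap.normDet_eq_zero_iff_ker_ne_bot.2 hker
  rw [normDet_prismMap_edgeMap S h, inner_edge_outwardNormal S h.ne, mul_eq_zero,
    LinearMap.normDet_eq_zero_iff_ker_ne_bot] at h0
  rcases h0 with h0 | h0
  · have := S.height_pos j
    simp only [abs_neg, abs_eq_zero] at h0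
    linarith
  · exact h0 (LinearMap.ker_eq_bot.2 (edgeMap_injective S h))

theorem simplexFacet_eq_image (h : IsEdgeFrame i j ρ) :
    simplexFacet S j = (fun z : Fin m → ℝ => S.points i +
      ∑ k, z k • (S.points (ρ k) - S.points i)) '' cornerSimplex (Fin m) := by
  rw [simplexFacet, ← convexHull_insert_range _ fun k => S.points (ρ k)]
  congr 1
  have : ({j}ᶜ : Set (Fin (m + 2))) = insert i (Set.range ρ) := by
    ext k
    rw [h.range_eq]
    have := h.ne
    by_cases hk : k = i
    · simp [hk, this]
    · simp [hk]
  rw [this, Set.image_insert_eq, ← Set.range_comp]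
  rfl

theorem simplexFacet_eq_image' (h : IsEdgeFrame i j ρ) :
    simplexFacet S j = (fun z => S.points i + edgeMap S i ρ z) ''
      (WithLp.ofLp ⁻¹' cornerSimplex (Fin m)) := by
  rw [simplexFacet_eq_image S h]
  ext x
  constructor
  · rintro ⟨z, hz, rfl⟩
    exact ⟨WithLp.toLp 2 z, hz, by simp [edgeMap_apply]⟩
  · rintro ⟨z, hz, rfl⟩
    exact ⟨WithLp.ofLp z, hz, by simp [edgeMap_apply]⟩

theorem setIntegral_ofLp_preimage (s : Set (Fin m → ℝ)) (g : (Fin m → ℝ) → ℝ) :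
    ∫ z : EuclideanSpace ℝ (Fin m) in WithLp.ofLp ⁻¹' s, g (WithLp.ofLp z) = ∫ z in s, g z :=
  (PiLp.volume_preserving_ofLp (Fin m)).setIntegral_preimage_emb
    (MeasurableEquiv.toLp 2 (Fin m → ℝ)).symm.measurableEmbedding g s

theorem setIntegral_simplexFacet (h : IsEdgeFrame i j ρ) (g : Space (m + 1) → ℝ) :
    ∫ x in simplexFacet S j, g x ∂(μHE[m] : Measure (Space (m + 1))) =
      (edgeMap S i ρ).normDet * ∫ z in cornerSimplex (Fin m),
        g (S.points i + ∑ k, z k • (S.points (ρ k) - S.points i)) := by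
  have h1 := setIntegral_affine_image (S.points i) (edgeMap S i ρ) (edgeMap_injective S h)
    (WithLp.ofLp ⁻¹' cornerSimplex (Fin m)) g
  rw [finrank_euclideanSpace_fin] at h1
  rw [simplexFacet_eq_image' S h, h1, ← setIntegral_ofLp_preimage]
  simp only [edgeMap_apply]

theorem convexHull_range_points_eq_image (h : IsEdgeFrame i j ρ) :
    convexHull ℝ (Set.range S.points) =
      (fun y => S.points i + prismMap (S.points j - S.points i) (edgeMap S i ρ) y) ''
        {y | 0 ≤ y.fst ∧ (∀ k, 0 ≤ y.snd k) ∧ y.fst + ∑ k, y.snd k ≤ 1} := by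
  have h0 : Set.range S.points = insert (S.points i)
      (Set.range fun o : Option (Fin m) => o.elim (S.points j) fun k => S.points (ρ k)) := by
    have hu : (Set.univ : Set (Fin (m + 2))) = insert i (insert j (Set.range ρ)) := by
      ext k
      rw [h.range_eq]
      simp only [Set.mem_univ, Set.mem_insert_iff, Set.mem_compl_iff, Set.mem_singleton_iff]
      tauto
    rw [← Set.image_univ, hu, Set.image_insert_eq, Set.image_insert_eq, ← Set.range_comp]
    congr 1
    ext x
    simp [Option.exists, eq_comm]
  rw [h0, convexHull_insert_range]
  ext x
  constructor
  · rintro ⟨w, ⟨hw, hw'⟩, rfl⟩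
    refine ⟨WithLp.toLp 2 (w none, WithLp.toLp 2 fun k => w (some k)), ⟨hw _, fun k => hw _, ?_⟩,
      ?_⟩
    · simpa [Fintype.sum_option] using hw'
    · simp [Fintype.sum_option, edgeMap_apply]
  · rintro ⟨y, ⟨h1, h2, h3⟩, rfl⟩
    refine ⟨fun o => o.elim y.fst y.snd, ⟨?_, ?_⟩, ?_⟩
    · rintro (_ | k)
      · exact h1
      · exact h2 k
    · simpa [Fintype.sum_option] using h3
    · simp [Fintype.sum_option, edgeMap_apply]

theorem setIntegral_simplex (h : IsEdgeFrame i j ρ) (g : Space (m + 1) → ℝ) :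
    ∫ x in convexHull ℝ (Set.range S.points), g x =
      (prismMap (S.points j - S.points i) (edgeMap S i ρ)).normDet *
        ∫ y in {y : ℝ × (Fin m → ℝ) | 0 ≤ y.1 ∧ (∀ k, 0 ≤ y.2 k) ∧ y.1 + ∑ k, y.2 k ≤ 1},
          g (S.points i + (y.1 • (S.points j - S.points i) +
            ∑ k, y.2 k • (S.points (ρ k) - S.points i))) := by
  have h1 := setIntegral_affine_image (S.points i) _ (prismMap_edgeMap_injective S h)
    {y | 0 ≤ y.fst ∧ (∀ k, 0 ≤ y.snd k) ∧ y.fst + ∑ k, y.snd k ≤ 1} g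
  have hfin : Module.finrank ℝ (WithLp 2 (ℝ × EuclideanSpace ℝ (Fin m))) = m + 1 := by
    rw [(WithLp.linearEquiv 2 ℝ (ℝ × EuclideanSpace ℝ (Fin m))).finrank_eq]
    simp [add_comm]
  rw [hfin, EuclideanSpace.euclideanHausdorffMeasure_eq_volume] at h1
  rw [convexHull_range_points_eq_image S h, h1]
  congr 1
  have hp : MeasurePreserving
      (fun y : WithLp 2 (ℝ × EuclideanSpace ℝ (Fin m)) => (y.fst, WithLp.ofLp y.snd))
      volume volume :=
    ((MeasurePreserving.id volume).prod (PiLp.volume_preserving_ofLp (Fin m))).comp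
      (WithLp.volume_preserving_ofLp ℝ (EuclideanSpace ℝ (Fin m)))
  have he : MeasurableEmbedding
      (fun y : WithLp 2 (ℝ × EuclideanSpace ℝ (Fin m)) => (y.fst, WithLp.ofLp y.snd)) :=
    (MeasurableEmbedding.id.prodMap
      (MeasurableEquiv.toLp 2 (Fin m → ℝ)).symm.measurableEmbedding).comp
      (MeasurableEquiv.toLp 2 (ℝ × EuclideanSpace ℝ (Fin m))).symm.measurableEmbedding
  rw [← hp.setIntegral_preimage_emb he]
  simp only [prismMap_apply, edgeMap_apply]
  rfl

theorem volume_simplex_ne_zero :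
    (volume : Measure (Space (m + 1))).real (convexHull ℝ (Set.range S.points)) ≠ 0 := by
  have h1 : affineSpan ℝ (Set.range S.points) = ⊤ := by
    rw [S.independent.affineSpan_eq_top_iff_card_eq_finrank_add_one]
    simp
  have h2 := interior_convexHull_nonempty_iff_affineSpan_eq_top.2 h1
  have h3 := (Set.finite_range S.points).isCompact_convexHull (𝕜 := ℝ)
  exact (ENNReal.toReal_pos (Measure.measure_pos_of_nonempty_interior _ h2).ne'
    h3.measure_lt_top.ne).ne'

/-- Both Jacobians turn the volume of the same reference simplex into that of `S`; this volume is
nonzero, so the common factor cancels. -/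
theorem normDet_prismMap_edgeMap_symm (h : IsEdgeFrame i j ρ) :
    (prismMap (S.points i - S.points j) (edgeMap S j ρ)).normDet =
      (prismMap (S.points j - S.points i) (edgeMap S i ρ)).normDet := by
  have h1 := setIntegral_simplex S h fun _ => 1
  have h2 := setIntegral_simplex S h.symm fun _ => 1
  have h0 := volume_simplex_ne_zero S
  simp only [setIntegral_const, smul_eq_mul, mul_one] at h1 h2
  rw [h1] at h0 h2
  exact (mul_right_cancel₀ (right_ne_zero_of_mul h0) h2).symm

/-- The divergence theorem on a simplex, for a vector field in the direction of an edge. -/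
theorem setIntegral_fderiv_edge (h : IsEdgeFrame i j ρ) (f : Space (m + 1) → ℝ)
    (hf : ContDiff ℝ 1 f) :
    ∫ x in convexHull ℝ (Set.range S.points), fderiv ℝ f x (S.points j - S.points i) =
      ∑ k, inner ℝ (S.points j - S.points i) (outwardNormal S k) *
        ∫ x in simplexFacet S k, f x ∂(μHE[m] : Measure (Space (m + 1))) := by
  have hfd : Continuous (fderiv ℝ f) := hf.continuous_fderiv one_ne_zero
  have hfc : Continuous f := hf.continuous
  rw [setIntegral_simplex S h, setIntegral_cornerSimplex_prod
    (fun s z => f (S.points i + (s • (S.points j - S.points i) +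
            ∑ k, z k • (S.points (ρ k) - S.points i))))
    (fun s z => fderiv ℝ f (S.points i + (s • (S.points j - S.points i) +
            ∑ k, z k • (S.points (ρ k) - S.points i))) (S.points j - S.points i))]
  · have hsum : ∑ k, inner ℝ (S.points j - S.points i) (outwardNormal S k) *
        ∫ x in simplexFacet S k, f x ∂(μHE[m] : Measure (Space (m + 1))) =
        inner ℝ (S.points j - S.points i) (outwardNormal S i) *
        (∫ x in simplexFacet S i, f x ∂(μHE[m] : Measure (Space (m + 1)))) +
        inner ℝ (S.points j - S.points i) (outwardNormal S j) *
        ∫ x in simplexFacet S j, f x ∂(μHE[m] : Measure (Space (m + 1))) := by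
      refine Fintype.sum_eq_add i j h.ne fun k hk => ?_
      rw [real_inner_comm, inner_outwardNormal_edge_eq_zero S hk.1.symm hk.2.symm, zero_mul]
    have hi : 0 ≤ inner ℝ (S.points j - S.points i) (outwardNormal S i) := by
      rw [← neg_sub, inner_neg_left, inner_edge_outwardNormal S h.ne.symm, neg_neg]
      exact (S.height_pos i).le
    have hj : inner ℝ (S.points j - S.points i) (outwardNormal S j) ≤ 0 := by
      rw [inner_edge_outwardNormal S h.ne]
      exact neg_nonpos.2 (S.height_pos j).le
    -- The Jacobian of the simplex is `|e · n|` times that of either end facet, `e` being the edge.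
    -- Its two factorizations turn the boundary values of the fundamental theorem of calculus into
    -- the two facet integrals with the right signs.
    have hDj := normDet_prismMap_edgeMap S h
    have hDi := normDet_prismMap_edgeMap S h.symm
    rw [normDet_prismMap_edgeMap_symm S h, ← neg_sub (S.points j), inner_neg_left, abs_neg,
      abs_of_nonneg hi] at hDi
    rw [abs_of_nonpos hj] at hDj
    -- The upper end `s = 1 - ∑ k, z k` runs over the facet opposite to `i`, in its parametrization
    -- from `j`.
    have hpt : ∀ z : Fin m → ℝ, S.points i + ((1 - ∑ k, z k) • (S.points j - S.points i) +
        ∑ k, z k • (S.points (ρ k) - S.points i)) =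
        S.points j + ∑ k, z k • (S.points (ρ k) - S.points j) := fun z => by
      simp only [smul_sub, Finset.sum_sub_distrib, ← Finset.sum_smul, sub_smul, one_smul]
      abel
    simp only [hpt, zero_smul, zero_add]
    rw [hsum, setIntegral_simplexFacet S h, setIntegral_simplexFacet S h.symm, ← mul_assoc,
      ← hDi, mul_sub, ← mul_assoc, ← neg_neg (inner ℝ _ (outwardNormal S j)), neg_mul, ← hDj]
    ring
  · intro s z
    have h1 : HasDerivAt (fun t : ℝ => S.points i + (t • (S.points j - S.points i) +
            ∑ k, z k • (S.points (ρ k) - S.points i))) (S.points j - S.points i) s := by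
      have := ((hasDerivAt_id s).smul_const (S.points j - S.points i)).add_const
        (∑ k, z k • (S.points (ρ k) - S.points i)) |>.const_add (S.points i)
      simpa using this
    exact ((hf.differentiable one_ne_zero _).hasFDerivAt).comp_hasDerivAt s h1
  · fun_prop
  · fun_prop

end EdgeFrame

/-! ### Divergence theorem on a simplex, in any constant direction. -/

section SimplexDivergence

variable {d : ℕ} (S : Affine.Simplex ℝ (Space d) d)

theorem isCompact_simplex : IsCompact (convexHull ℝ (Set.range S.points)) :=
  (Set.finite_range S.points).isCompact_convexHull (𝕜 := ℝ)

theorem isCompact_simplexFacet (j : Fin (d + 1)) : IsCompact (simplexFacet S j) :=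
  ((Set.toFinite _).image _).isCompact_convexHull (𝕜 := ℝ)

variable [NeZero d]

theorem simplexFacet_nonempty (j : Fin (d + 1)) : (simplexFacet S j).Nonempty := by
  obtain ⟨k, hk⟩ := exists_ne j
  exact ⟨S.points k, subset_convexHull ℝ _ ⟨k, hk, rfl⟩⟩

theorem measure_simplexFacet_lt_top (j : Fin (d + 1)) :
    (μHE[d - 1] : Measure (Space d)) (simplexFacet S j) < ⊤ := by
  obtain ⟨m, rfl⟩ := Nat.exists_eq_succ_of_ne_zero (NeZero.ne d)
  obtain ⟨i, hi⟩ := exists_ne j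
  obtain ⟨ρ, h⟩ := exists_isEdgeFrame hi
  have h1 := euclideanHausdorffMeasure_affine_image (S.points i) (edgeMap S i ρ)
    (WithLp.ofLp ⁻¹' cornerSimplex (Fin m))
  rw [finrank_euclideanSpace_fin, ← simplexFacet_eq_image' S h] at h1
  have h2 := (PiLp.volume_preserving_ofLp (Fin m)).measure_preimage
    (isCompact_cornerSimplex (Fin m)).isClosed.measurableSet.nullMeasurableSet
  rw [Nat.succ_sub_one, h1, h2]
  exact ENNReal.mul_lt_top ENNReal.ofReal_lt_top (isCompact_cornerSimplex (Fin m)).measure_lt_top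

theorem integrableOn_simplexFacet (j : Fin (d + 1)) {f : Space d → ℝ} (hf : Continuous f) :
    IntegrableOn f (simplexFacet S j) (μHE[d - 1] : Measure (Space d)) := by
  obtain ⟨C, hC⟩ := (isCompact_simplexFacet S j).exists_bound_of_continuousOn hf.continuousOn
  refine Measure.integrableOn_of_bounded (M := C) (measure_simplexFacet_lt_top S j).ne
    hf.aestronglyMeasurable ?_
  exact ae_restrict_of_forall_mem (isCompact_simplexFacet S j).isClosed.measurableSet hC

/-- The divergence theorem on a simplex, for a vector field of constant direction. -/
theorem setIntegral_fderiv_simplex (e : Space d) (f : Space d → ℝ) (hf : ContDiff ℝ 1 f) :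
    ∫ x in convexHull ℝ (Set.range S.points), fderiv ℝ f x e =
      ∑ k, inner ℝ e (outwardNormal S k) *
        ∫ x in simplexFacet S k, f x ∂(μHE[d - 1] : Measure (Space d)) := by
  have hfd : Continuous (fderiv ℝ f) := hf.continuous_fderiv one_ne_zero
  have hint (v : Space d) :
      IntegrableOn (fun x => fderiv ℝ f x v) (convexHull ℝ (Set.range S.points)) :=
    (Continuous.continuousOn (by fun_prop)).integrableOn_compact (isCompact_simplex S)
  -- Both sides are linear in `e`, so the edges from the vertex `0` suffice.
  have hspan : Submodule.span ℝ ((· -ᵥ S.points 0) '' Set.range S.points) = ⊤ := by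
    rw [← vectorSpan_eq_span_vsub_set_right ℝ (Set.mem_range_self 0)]
    exact S.independent.vectorSpan_eq_top_of_card_eq_finrank_add_one (by simp)
  have he : e ∈ Submodule.span ℝ ((· -ᵥ S.points 0) '' Set.range S.points) :=
    hspan ▸ Submodule.mem_top
  induction he using Submodule.span_induction with
  | mem x hx =>
    obtain ⟨_, ⟨j, rfl⟩, rfl⟩ := hx
    by_cases hj : j = 0
    · simp [hj]
    · obtain ⟨m, rfl⟩ := Nat.exists_eq_succ_of_ne_zero (NeZero.ne d)
      obtain ⟨ρ, h⟩ := exists_isEdgeFrame (Ne.symm hj)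
      exact setIntegral_fderiv_edge S h f hf
  | zero => simp
  | add x y _ _ hx hy =>
    simp only [map_add, inner_add_left, add_mul, Finset.sum_add_distrib]
    rw [integral_add (hint x) (hint y), hx, hy]
  | smul c x _ hx =>
    simp only [map_smul, smul_eq_mul, real_inner_smul_left, mul_assoc, ← Finset.mul_sum]
    rw [integral_const_mul, hx]

end SimplexDivergence

/-! ### Polynomials as smooth functions, and their divergence theorem. -/

section PolynomialFunctions

variable {d : ℕ}

theorem hasFDerivAt_eval (q : MvPolynomial (Fin d) ℝ) (x : Space d) :
    HasFDerivAt (fun y : Space d => MvPolynomial.eval (fun l => y l) q)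
      (∑ i, MvPolynomial.eval (fun l => x l) (MvPolynomial.pderiv i q) •
        (EuclideanSpace.proj i : Space d →L[ℝ] ℝ)) x := by
  induction q using MvPolynomial.induction_on with
  | C a => simpa using hasFDerivAt_const a x
  | add p q hp hq =>
    simp only [map_add, add_smul, Finset.sum_add_distrib]
    exact hp.add hq
  | mul_X p j hp =>
    have hj : HasFDerivAt (fun y : Space d => y j) (EuclideanSpace.proj j : Space d →L[ℝ] ℝ) x :=
      (EuclideanSpace.proj j : Space d →L[ℝ] ℝ).hasFDerivAt
    have h := hp.mul hj
    simp only [map_mul, MvPolynomial.eval_X]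
    refine h.congr_fderiv ?_
    simp only [Derivation.leibniz, MvPolynomial.pderiv_X, smul_eq_mul, map_add, map_mul,
      MvPolynomial.eval_X, add_smul, Finset.sum_add_distrib, mul_smul, ← Finset.smul_sum]
    congr 2
    rw [Finset.sum_eq_single j]
    · simp
    · intro i _ hij
      simp [hij.symm]
    · simp

theorem contDiff_eval (q : MvPolynomial (Fin d) ℝ) (n : WithTop ℕ∞) :
    ContDiff ℝ n fun y : Space d => MvPolynomial.eval (fun l => y l) q := by
  induction q using MvPolynomial.induction_on with
  | C a => simpa using contDiff_const
  | add p q hp hq => simpa using hp.add hq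
  | mul_X p j hp =>
    simp only [map_mul, MvPolynomial.eval_X]
    exact hp.mul (EuclideanSpace.proj j : Space d →L[ℝ] ℝ).contDiff

@[fun_prop]
theorem continuous_eval_space (q : MvPolynomial (Fin d) ℝ) :
    Continuous fun y : Space d => MvPolynomial.eval (fun l => y l) q :=
  (contDiff_eval q 0).continuous

variable [NeZero d] (S : Affine.Simplex ℝ (Space d) d)

/-- The divergence theorem on a simplex, for polynomial vector fields. -/
theorem setIntegral_divergence_simplex (P : Fin d → MvPolynomial (Fin d) ℝ) :
    ∫ x in convexHull ℝ (Set.range S.points),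
        MvPolynomial.eval (fun l => x l) (∑ i, MvPolynomial.pderiv i (P i)) =
      ∑ k, ∫ x in simplexFacet S k,
        ∑ i, outwardNormal S k i * MvPolynomial.eval (fun l => x l) (P i)
          ∂(μHE[d - 1] : Measure (Space d)) := by
  have h1 (i : Fin d) := setIntegral_fderiv_simplex S (EuclideanSpace.single i 1) _
    (contDiff_eval (P i) 1)
  simp only [(hasFDerivAt_eval (P _) _).fderiv, _root_.sum_apply,
    _root_.smul_apply, PiLp.proj_apply, PiLp.single_apply, smul_eq_mul, mul_ite,
    mul_one, mul_zero, Finset.sum_ite_eq', Finset.mem_univ, if_true,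
    EuclideanSpace.inner_single_left, map_one, one_mul] at h1
  simp only [map_sum]
  rw [integral_finsetSum]
  · rw [Finset.sum_congr rfl fun i _ => h1 i, Finset.sum_comm]
    refine Finset.sum_congr rfl fun k _ => ?_
    rw [integral_finsetSum]
    · simp only [integral_const_mul]
    · intro i _
      exact (integrableOn_simplexFacet S k (continuous_eval_space (P i))).const_mul _
  · intro i _
    exact (continuous_eval_space _).continuousOn.integrableOn_compact (isCompact_simplex S)

end PolynomialFunctions

/-! ### Integration by parts on an element. -/

namespace PeriodicMesh

variable {d : ℕ} {ι : Type*}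

theorem inner_val (v w : PwPoly d ι) (T T' : ι) (x y : Space d) :
    inner ℝ (val v T x) (val w T' y) =
      ∑ j, MvPolynomial.eval (fun l => x l) (v T j) *
        MvPolynomial.eval (fun l => y l) (w T' j) := by
  simp [val, PiLp.inner_apply, mul_comm]

@[fun_prop]
theorem continuous_val (v : PwPoly d ι) (T : ι) : Continuous (val v T) :=
  (PiLp.continuous_toLp 2 _).comp (continuous_pi fun j => continuous_eval_space (v T j))

@[fun_prop]
theorem continuous_innerTrace (v : PwPoly d ι) (h : ι × Fin (d + 1)) :
    Continuous (innerTrace v h) :=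
  continuous_val v h.1

@[fun_prop]
theorem continuous_tensorGrad (w a v : PwPoly d ι) (T : ι) : Continuous (tensorGrad w a v T) := by
  unfold tensorGrad val
  fun_prop

variable [NeZero d] {Ω : Set (Space d)} [Fintype ι] (M : PeriodicMesh d Ω ι)

theorem integrableOn_elem (T : ι) {f : Space d → ℝ} (hf : Continuous f) :
    IntegrableOn f (M.elem T) :=
  hf.continuousOn.integrableOn_compact (isCompact_simplex (M.cell T))

theorem integrableOn_facet (h : ι × Fin (d + 1)) {f : Space d → ℝ} (hf : Continuous f) :
    IntegrableOn f (M.facet h) (μHE[d - 1] : Measure (Space d)) :=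
  integrableOn_simplexFacet _ _ hf

/-- Integration by parts on an element, for an advecting field of vanishing divergence. -/
theorem integral_tensorGrad_add (w a b : PwPoly d ι) (T : ι)
    (hw : ∑ j, MvPolynomial.pderiv j (w T j) = 0) :
    (∫ x in M.elem T, tensorGrad w a b T x) + (∫ x in M.elem T, tensorGrad w b a T x) =
      ∑ i : Fin (d + 1), ∫ x in M.facet (T, i), M.normalComp w (T, i) x *
        inner ℝ (innerTrace a (T, i) x) (innerTrace b (T, i) x)
          ∂(μHE[d - 1] : Measure (Space d)) := by
  rw [← integral_add (M.integrableOn_elem T (continuous_tensorGrad w a b T))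
    (M.integrableOn_elem T (continuous_tensorGrad w b a T))]
  have h := setIntegral_divergence_simplex (M.cell T) fun i => w T i * ∑ j, a T j * b T j
  -- In the product rule for `(a · b) w`, the term `(a · b) div w` vanishes.
  have hdiv : ∑ i, MvPolynomial.pderiv i (w T i * ∑ j, a T j * b T j) =
      ∑ i, ∑ j, w T i * (a T j * MvPolynomial.pderiv i (b T j) +
        b T j * MvPolynomial.pderiv i (a T j)) := by
    simp only [Derivation.leibniz, map_sum, smul_eq_mul, Finset.sum_add_distrib, ← Finset.mul_sum,
      hw, mul_zero, add_zero]
  rw [hdiv] at h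
  have hl (x : Space d) : tensorGrad w a b T x + tensorGrad w b a T x =
      MvPolynomial.eval (fun l => x l) (∑ i, ∑ j, w T i * (a T j * MvPolynomial.pderiv i (b T j) +
        b T j * MvPolynomial.pderiv i (a T j))) := by
    simp only [tensorGrad, val, map_sum, map_mul, map_add, ← Finset.sum_add_distrib]
    refine Finset.sum_congr rfl fun i _ => Finset.sum_congr rfl fun j _ => ?_
    ring
  have hr (k : Fin (d + 1)) (x : Space d) : M.normalComp w (T, k) x *
        inner ℝ (innerTrace a (T, k) x) (innerTrace b (T, k) x) =
      ∑ i, outwardNormal (M.cell T) k i *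
        MvPolynomial.eval (fun l => x l) (w T i * ∑ j, a T j * b T j) := by
    simp only [normalComp, innerTrace, inner_val, map_mul, map_sum, normal, ← mul_assoc,
      ← Finset.sum_mul]
    simp [val, PiLp.inner_apply]
  simp only [hl, hr]
  exact h

/-! ### Pairing of sides into facets, and the energy identity. -/

theorem measurableSet_facet (h : ι × Fin (d + 1)) : MeasurableSet (M.facet h) :=
  (isCompact_simplexFacet _ _).isClosed.measurableSet

/-- Otherwise the unit normal would equal its own negative. -/
theorem mate_ne (h : ι × Fin (d + 1)) : M.mate h ≠ h := fun hh => by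
  have h1 := M.normal_mate h
  rw [hh, eq_neg_iff_add_eq_zero, ← two_smul ℝ, smul_eq_zero_iff_right two_ne_zero] at h1
  have h2 := norm_outwardNormal (M.cell h.1) h.2
  simp [h1] at h2

theorem add_shift_mem {h : ι × Fin (d + 1)} {x : Space d} (hx : x ∈ M.facet h) :
    x + M.shift h ∈ M.facet (M.mate h) := by
  rw [facet, M.facet_mate]
  exact ⟨x, hx, rfl⟩

/-- Going across and back translates the facet into itself by `s`. The maximum of `⟨s, ·⟩` on the
compact facet would grow by `‖s‖²`, so `s = 0`. -/
theorem shift_mate (h : ι × Fin (d + 1)) : M.shift (M.mate h) = -M.shift h := by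
  set s := M.shift h + M.shift (M.mate h) with hs
  obtain ⟨x, hx, hmax⟩ := (isCompact_simplexFacet (M.cell h.1) h.2).exists_isMaxOn
    (simplexFacet_nonempty _ _) (f := fun y => inner ℝ s y) (by fun_prop)
  have hx' := M.add_shift_mem (M.add_shift_mem (h := h) hx)
  rw [M.mate_mate, add_assoc, ← hs] at hx'
  have h1 := hmax hx'
  simp only [Set.mem_ofPred_eq, inner_add_right] at h1
  rw [real_inner_self_eq_norm_sq] at h1
  have h2 : ‖s‖ ^ 2 = 0 := le_antisymm (by linarith) (sq_nonneg _)
  have h3 : s = 0 := norm_eq_zero.1 (pow_eq_zero_iff two_ne_zero |>.1 h2)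
  exact eq_neg_of_add_eq_zero_right h3

theorem setIntegral_facet_mate (h : ι × Fin (d + 1)) (g : Space d → ℝ) :
    ∫ x in M.facet (M.mate h), g x ∂(μHE[d - 1] : Measure (Space d)) =
      ∫ x in M.facet h, g (x + M.shift h) ∂(μHE[d - 1] : Measure (Space d)) := by
  rw [facet, M.facet_mate]
  exact (measurePreserving_add_right _ (M.shift h)).setIntegral_image_emb
    (measurableEmbedding_addRight _) g _

theorem innerTrace_mate (v : PwPoly d ι) (h : ι × Fin (d + 1)) (x : Space d) :
    innerTrace v (M.mate h) (x + M.shift h) = M.outerTrace v h x := rfl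

theorem outerTrace_mate (v : PwPoly d ι) (h : ι × Fin (d + 1)) (x : Space d) :
    M.outerTrace v (M.mate h) (x + M.shift h) = innerTrace v h x := by
  rw [outerTrace, M.mate_mate, M.shift_mate, add_neg_cancel_right, innerTrace]

theorem normalComp_mate {k : ℕ} {w : PwPoly d ι} (hw : w ∈ M.divFreeSpace k)
    {h : ι × Fin (d + 1)} {x : Space d} (hx : x ∈ M.facet h) :
    M.normalComp w (M.mate h) (x + M.shift h) = -M.normalComp w h x := by
  have h1 := hw.2.1 h x hx
  rw [inner_sub_left, sub_eq_zero] at h1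
  rw [normalComp, normalComp, innerTrace_mate, h1, ← inner_neg_right]
  congr 1
  exact M.normal_mate h

@[fun_prop]
theorem continuous_outerTrace (v : PwPoly d ι) (h : ι × Fin (d + 1)) :
    Continuous (M.outerTrace v h) :=
  (continuous_val v _).comp (continuous_add_const _)

@[fun_prop]
theorem continuous_normalComp (v : PwPoly d ι) (h : ι × Fin (d + 1)) :
    Continuous (M.normalComp v h) := by
  unfold normalComp
  fun_prop

/-- Each class consists of exactly two distinct sides, by `mate_ne`. -/
theorem sum_sides_eq_sum_facets (f : ι × Fin (d + 1) → ℝ) :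
    ∑ h, f h = ∑ F : M.Facet, (f F.out + f (M.mate F.out)) := by
  classical
  rw [← Finset.sum_fiberwise Finset.univ (fun h => (Quotient.mk M.facetSetoid h : M.Facet)) f]
  refine Finset.sum_congr rfl fun F _ => ?_
  rw [← Finset.sum_pair (M.mate_ne F.out).symm]
  refine Finset.sum_congr ?_ fun _ _ => rfl
  ext h
  simp only [Finset.mem_filter, Finset.mem_univ, true_and, Finset.mem_insert,
    Finset.mem_singleton]
  rw [eq_comm, Quotient.eq_mk_iff_out]
  rfl

theorem sum_integral_sides (G : ι × Fin (d + 1) → Space d → ℝ) (hG : ∀ h, Continuous (G h)) :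
    ∑ h, ∫ x in M.facet h, G h x ∂(μHE[d - 1] : Measure (Space d)) =
      M.sumFacets fun h x => G h x + G (M.mate h) (x + M.shift h) := by
  rw [M.sum_sides_eq_sum_facets, sumFacets]
  refine Finset.sum_congr rfl fun F _ => ?_
  have h1 : Continuous fun x => G (M.mate F.out) (x + M.shift F.out) :=
    (hG _).comp (continuous_add_const _)
  rw [integral_add (M.integrableOn_facet _ (hG _)) (M.integrableOn_facet _ h1),
    setIntegral_facet_mate]

theorem sumFacets_congr {f g : ι × Fin (d + 1) → Space d → ℝ}
    (hfg : ∀ h, ∀ x ∈ M.facet h, f h x = g h x) : M.sumFacets f = M.sumFacets g :=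
  Finset.sum_congr rfl fun _ _ => setIntegral_congr_fun (M.measurableSet_facet _) (hfg _)

theorem sumFacets_nonneg {f : ι × Fin (d + 1) → Space d → ℝ} (hf : ∀ h x, 0 ≤ f h x) :
    0 ≤ M.sumFacets f :=
  Finset.sum_nonneg fun _ _ => integral_nonneg (hf _)

theorem sumFacets_const_mul (c : ℝ) (f : ι × Fin (d + 1) → Space d → ℝ) :
    M.sumFacets (fun h x => c * f h x) = c * M.sumFacets f := by
  simp only [sumFacets, integral_const_mul, Finset.mul_sum]

theorem sumFacets_add {f g : ι × Fin (d + 1) → Space d → ℝ} (hf : ∀ h, Continuous (f h))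
    (hg : ∀ h, Continuous (g h)) :
    M.sumFacets (fun h x => f h x + g h x) = M.sumFacets f + M.sumFacets g := by
  rw [sumFacets, sumFacets, sumFacets, ← Finset.sum_add_distrib]
  exact Finset.sum_congr rfl fun _ _ =>
    integral_add (M.integrableOn_facet _ (hf _)) (M.integrableOn_facet _ (hg _))

/-- The jump of `v` across the facet, seen from the element of the side `h`. -/
def sideJump (v : PwPoly d ι) (h : ι × Fin (d + 1)) (x : Space d) : Space d :=
  M.outerTrace v h x - innerTrace v h x

@[fun_prop]
theorem continuous_sideJump (v : PwPoly d ι) (h : ι × Fin (d + 1)) :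
    Continuous (M.sideJump v h) := by
  unfold sideJump
  fun_prop

/-- The convective flux of `ahat` in the normal direction is a central flux, stabilized by the jump
of `c` with the factor `ε`. -/
def IsStabilizedFlux (w a c : PwPoly d ι) (ε : ℝ)
    (ahat : ι × Fin (d + 1) → Space d → Space d) : Prop :=
  ∀ h, ∀ x ∈ M.facet h, M.normalComp w h x • ahat h x =
    (M.normalComp w h x / 2) • (innerTrace a h x + M.outerTrace a h x) +
      (ε * |M.normalComp w h x| / 2) • M.sideJump c h x

/-- The labelling is an arbitrary pointwise predicate, so `ahat` need not be measurable. The new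
integrand involves only continuous traces, which allows the integrals to be split and recombined. -/
theorem convForm_eq_of_isStabilizedFlux {w a b c : PwPoly d ι} {ε : ℝ}
    {ahat : ι × Fin (d + 1) → Space d → Space d} (ha : M.IsStabilizedFlux w a c ε ahat) :
    M.convForm w a ahat b = -(∑ T, ∫ x in M.elem T, tensorGrad w a b T x) +
      ∑ h, ∫ x in M.facet h, (M.normalComp w h x / 2 *
        inner ℝ (innerTrace a h x + M.outerTrace a h x) (innerTrace b h x) +
        ε * |M.normalComp w h x| / 2 * inner ℝ (M.sideJump c h x) (innerTrace b h x))
          ∂(μHE[d - 1] : Measure (Space d)) := by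
  rw [convForm, Finset.sum_add_distrib, Finset.sum_neg_distrib, Fintype.sum_prod_type]
  congr 1
  refine Finset.sum_congr rfl fun T _ => Finset.sum_congr rfl fun i _ => ?_
  refine setIntegral_congr_fun (M.measurableSet_facet _) fun x hx => ?_
  rw [← real_inner_smul_left, ha _ x hx, inner_add_left, real_inner_smul_left,
    real_inner_smul_left]

/-- The energy identity for a pair of convective forms with stabilized fluxes. -/
theorem convForm_add_convForm {k : ℕ} {w a b c c' : PwPoly d ι} {ε : ℝ}
    (hw : w ∈ M.divFreeSpace k) {ahat bhat : ι × Fin (d + 1) → Space d → Space d}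
    (ha : M.IsStabilizedFlux w a c ε ahat) (hb : M.IsStabilizedFlux w b c' ε bhat) :
    M.convForm w a ahat b + M.convForm w b bhat a =
      -(ε / 2) * M.sumFacets (fun h x => |M.normalComp w h x| *
        (inner ℝ (M.sideJump c h x) (M.sideJump b h x) +
          inner ℝ (M.sideJump c' h x) (M.sideJump a h x))) := by
  have hbulk : (∑ T, ∫ x in M.elem T, tensorGrad w a b T x) +
      (∑ T, ∫ x in M.elem T, tensorGrad w b a T x) = ∑ h, ∫ x in M.facet h,
        M.normalComp w h x * inner ℝ (innerTrace a h x) (innerTrace b h x)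
          ∂(μHE[d - 1] : Measure (Space d)) := by
    rw [← Finset.sum_add_distrib, Fintype.sum_prod_type]
    exact Finset.sum_congr rfl fun T _ => M.integral_tensorGrad_add w a b T (hw.2.2 T)
  rw [M.convForm_eq_of_isStabilizedFlux ha, M.convForm_eq_of_isStabilizedFlux hb,
    add_add_add_comm, ← neg_add, hbulk, ← sumFacets_const_mul,
    M.sum_integral_sides _ fun h => by fun_prop, M.sum_integral_sides _ fun h => by fun_prop,
    M.sum_integral_sides _ fun h => by fun_prop, ← neg_one_mul, ← sumFacets_const_mul,
    ← M.sumFacets_add _ _, ← M.sumFacets_add _ _]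
  -- Passing to the mate negates `w · n` and exchanges inner and outer traces. The central terms
  -- cancel the bulk contribution pointwise and the products of jumps remain.
  · refine M.sumFacets_congr fun h x hx => ?_
    simp only [sideJump, innerTrace_mate, outerTrace_mate, M.normalComp_mate hw hx, abs_neg,
      inner_add_left, inner_sub_left, inner_sub_right]
    rw [real_inner_comm (innerTrace b h x) (innerTrace a h x),
      real_inner_comm (innerTrace b h x) (M.outerTrace a h x),
      real_inner_comm (M.outerTrace b h x) (innerTrace a h x),
      real_inner_comm (M.outerTrace b h x) (M.outerTrace a h x)]
    ring
  all_goals exact fun h => by fun_prop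

/-! ### The upwind fluxes as stabilized central fluxes. -/

variable {M} {u B : PwPoly d ι} {minus : ι × Fin (d + 1) → Space d → Prop} {k : ℕ}

theorem norm_jump (v : PwPoly d ι) (h : ι × Fin (d + 1)) (x : Space d) :
    ‖M.jump minus v h x‖ = ‖M.sideJump v h x‖ := by
  rw [jump, plusTrace, minusTrace, sideJump]
  split_ifs
  · rfl
  · exact norm_sub_rev _ _

/-- The mate is then `K⁻`, and outflow from it is inflow here. -/
theorem normalComp_nonpos_of_not_minus (hu : u ∈ M.divFreeSpace k)
    (hm : M.IsOutflowLabelling u minus) {h : ι × Fin (d + 1)} {x : Space d} (hx : x ∈ M.facet h)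
    (hn : ¬ minus h x) :
    minus (M.mate h) (x + M.shift h) ∧ M.normalComp u h x ≤ 0 := by
  have h1 : minus (M.mate h) (x + M.shift h) := by
    by_contra h2
    exact hn ((hm h x hx).1.2 h2)
  have h2 := (hm _ _ (M.add_shift_mem hx)).2 h1
  rw [M.normalComp_mate hu hx] at h2
  exact ⟨h1, by linarith⟩

theorem isStabilizedFlux_minusTrace (hu : u ∈ M.divFreeSpace k)
    (hm : M.IsOutflowLabelling u minus) (v : PwPoly d ι) :
    M.IsStabilizedFlux u v v (-1) (M.minusTrace minus v) := by
  intro h x hx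
  rw [minusTrace, sideJump]
  split_ifs with hmin
  · rw [abs_of_nonneg ((hm h x hx).2 hmin)]
    module
  · rw [abs_of_nonpos (normalComp_nonpos_of_not_minus hu hm hx hmin).2]
    module

theorem normalComp_mul_upwindSign (hu : u ∈ M.divFreeSpace k) (hB : B ∈ M.divFreeSpace k)
    (hm : M.IsOutflowLabelling u minus) (ht : M.ResolvesTies u B minus)
    {h : ι × Fin (d + 1)} {x : Space d} (hx : x ∈ M.facet h) (v : PwPoly d ι) :
    (M.normalComp B h x * M.upwindSign u B h x) • M.jump minus v h x =
      |M.normalComp B h x| • M.sideJump v h x := by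
  -- Here `p = u · n⁻` and `q = B · n⁻`; the second hypothesis is the tie rule, used when `p = 0`.
  have key : ∀ {p q : ℝ}, 0 ≤ p → (p = 0 → q ≤ 0) → q * (if 0 < q * p then 1 else -1) = |q| := by
    intro p q hp hpq
    split_ifs with h1
    · rw [abs_of_pos (pos_of_mul_pos_left h1 hp), mul_one]
    · have : q ≤ 0 := by
        rcases hp.eq_or_lt with h0 | h0
        · exact hpq h0.symm
        · exact nonpos_of_mul_nonpos_left (not_lt.1 h1) h0
      rw [abs_of_nonpos this, mul_neg_one]
  by_cases hmin : minus h x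
  · have h1 := key ((hm h x hx).2 hmin) (ht h x hx hmin)
    simp only [jump, plusTrace, minusTrace, if_pos hmin]
    rw [upwindSign, h1, sideJump]
  -- Now `n⁻ = -n`. The product defining `s_F` is unchanged, while `B · n` and the jump both change
  -- sign.
  · obtain ⟨hmin', h2⟩ := normalComp_nonpos_of_not_minus hu hm hx hmin
    have h3 := ht _ _ (M.add_shift_mem hx) hmin'
    rw [M.normalComp_mate hu hx, M.normalComp_mate hB hx] at h3
    have h1 := key (neg_nonneg.2 h2) h3
    rw [neg_mul_neg, abs_neg, neg_mul] at h1
    simp only [jump, plusTrace, minusTrace, if_neg hmin]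
    rw [upwindSign, ← h1, sideJump, neg_smul, ← smul_neg, neg_sub]

theorem average_eq (v : PwPoly d ι) (h : ι × Fin (d + 1)) (x : Space d) :
    M.average minus v h x = (1 / 2 : ℝ) • (innerTrace v h x + M.outerTrace v h x) := by
  rw [average, plusTrace, minusTrace]
  split_ifs
  · rw [add_comm]
  · rfl

theorem isStabilizedFlux_hatB (hu : u ∈ M.divFreeSpace k) (hB : B ∈ M.divFreeSpace k)
    (hm : M.IsOutflowLabelling u minus) (ht : M.ResolvesTies u B minus) :
    M.IsStabilizedFlux B B u 1 (M.hatB minus u B) := by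
  intro h x hx
  have h1 := normalComp_mul_upwindSign hu hB hm ht hx u
  rw [hatB, average_eq, smul_add, smul_smul, smul_smul, mul_left_comm _ (1 / 2 : ℝ),
    mul_smul (1 / 2 : ℝ), h1]
  module

theorem isStabilizedFlux_hatU (hu : u ∈ M.divFreeSpace k) (hB : B ∈ M.divFreeSpace k)
    (hm : M.IsOutflowLabelling u minus) (ht : M.ResolvesTies u B minus) :
    M.IsStabilizedFlux B u B 1 (M.hatU minus u B) := by
  intro h x hx
  have h1 := normalComp_mul_upwindSign hu hB hm ht hx B
  rw [hatU, average_eq, smul_add, smul_smul, smul_smul, mul_left_comm _ (1 / 2 : ℝ),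
    mul_smul (1 / 2 : ℝ), h1]
  module

theorem formUB_self (hu : u ∈ M.divFreeSpace k) (hm : M.IsOutflowLabelling u minus)
    (v : PwPoly d ι) :
    M.formUB minus u v v =
      1 / 2 * M.sumFacets (fun h x => |M.normalComp u h x| * ‖M.jump minus v h x‖ ^ 2) := by
  have hf := isStabilizedFlux_minusTrace hu hm v
  have h1 := M.convForm_add_convForm hu hf hf
  simp only [real_inner_self_eq_norm_sq, ← two_mul, mul_left_comm _ (2 : ℝ),
    sumFacets_const_mul] at h1
  simp only [norm_jump, formUB]
  linarith

theorem formUU_self (hu : u ∈ M.divFreeSpace k) (hm : M.IsOutflowLabelling u minus) :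
    M.formUU minus u u =
      1 / 2 * M.sumFacets (fun h x => |M.normalComp u h x| * ‖M.jump minus u h x‖ ^ 2) :=
  formUB_self hu hm u

theorem formBB_add_formBU (hu : u ∈ M.divFreeSpace k) (hB : B ∈ M.divFreeSpace k)
    (hm : M.IsOutflowLabelling u minus) (ht : M.ResolvesTies u B minus) :
    M.formBB minus u B u + M.formBU minus u B B =
      -(1 / 2) * M.sumFacets (fun h x => |M.normalComp B h x| *
        (‖M.jump minus u h x‖ ^ 2 + ‖M.jump minus B h x‖ ^ 2)) := by
  have h1 := M.convForm_add_convForm hB (isStabilizedFlux_hatB hu hB hm ht)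
    (isStabilizedFlux_hatU hu hB hm ht)
  simpa only [real_inner_self_eq_norm_sq, norm_jump, formBB, formBU] using h1

theorem dissipation_nonneg (minus : ι × Fin (d + 1) → Space d → Prop) (u B : PwPoly d ι) :
    0 ≤ M.dissipation minus u B :=
  M.sumFacets_nonneg fun _ _ => by positivity

/-- The rate of energy dissipation is that of the four convective forms. -/
theorem dissipation_eq (hu : u ∈ M.divFreeSpace k) (hB : B ∈ M.divFreeSpace k)
    (hm : M.IsOutflowLabelling u minus) (ht : M.ResolvesTies u B minus) :
    M.dissipation minus u B = 2 * (M.formUU minus u u + M.formUB minus u B B -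
      (M.formBB minus u B u + M.formBU minus u B B)) := by
  rw [formUU_self hu hm, formUB_self hu hm, formBB_add_formBU hu hB hm ht, dissipation]
  -- The labelled jump need not be continuous along a facet; its norm is that of the one-sided jump,
  -- which is, so the integrals may be split.
  simp only [norm_jump, add_mul]
  rw [M.sumFacets_add (fun _ => by fun_prop) (fun _ => by fun_prop)]
  simp only [mul_add]
  rw [M.sumFacets_add (fun _ => by fun_prop) (fun _ => by fun_prop),
    M.sumFacets_add (fun _ => by fun_prop) (fun _ => by fun_prop)]
  ring

end PeriodicMesh

/-! ### Time derivative of the energy. -/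

namespace PeriodicMesh

variable {d : ℕ} [NeZero d] {Ω : Set (Space d)} {ι : Type*} [Fintype ι] (M : PeriodicMesh d Ω ι)

theorem l2Inner_comm (v w : PwPoly d ι) : M.l2Inner v w = M.l2Inner w v := by
  simp only [l2Inner, real_inner_comm]

/-- Over a fixed finite set of exponents the inner product is a bilinear form in the coefficients
with constant moments. Its time derivative then needs no differentiation under an integral. -/
theorem l2Inner_eq_sum_coeff {v w : PwPoly d ι} {s : Finset (Fin d →₀ ℕ)}
    (hv : ∀ T j, (v T j).support ⊆ s) (hw : ∀ T j, (w T j).support ⊆ s) :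
    M.l2Inner v w = ∑ T, ∑ j, ∑ m ∈ s, ∑ m' ∈ s,
      (MvPolynomial.coeff m (v T j) * MvPolynomial.coeff m' (w T j)) *
        ∫ x in M.elem T, (∏ i, x i ^ m i) * ∏ i, x i ^ m' i := by
  have heval {q : MvPolynomial (Fin d) ℝ} (hq : q.support ⊆ s) (x : Space d) :
      MvPolynomial.eval (fun l => x l) q =
        ∑ m ∈ s, MvPolynomial.coeff m q * ∏ i, x i ^ m i := by
    rw [MvPolynomial.eval_eq']
    refine Finset.sum_subset hq fun m _ hm => ?_
    rw [MvPolynomial.notMem_support_iff.1 hm, zero_mul]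
  have hint (T : ι) (m m' : Fin d →₀ ℕ) (c : ℝ) :
      IntegrableOn (fun x : Space d => c * ((∏ i, x i ^ m i) * ∏ i, x i ^ m' i)) (M.elem T) :=
    M.integrableOn_elem T (by fun_prop)
  refine Finset.sum_congr rfl fun T _ => ?_
  simp only [inner_val, heval (hv _ _), heval (hw _ _), Finset.sum_mul_sum, mul_mul_mul_comm]
  rw [integral_finsetSum _ fun j _ => integrable_finsetSum _ fun m _ =>
    integrable_finsetSum _ fun m' _ => hint T m m' _]
  refine Finset.sum_congr rfl fun j _ => ?_
  rw [integral_finsetSum _ fun m _ => integrable_finsetSum _ fun m' _ => hint T m m' _]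
  refine Finset.sum_congr rfl fun m _ => ?_
  rw [integral_finsetSum _ fun m' _ => hint T m m' _]
  simp only [integral_const_mul]

theorem support_subset_Iic_of_totalDegree_le {σ R : Type*} [Finite σ] [CommSemiring R] {k : ℕ}
    {q : MvPolynomial σ R} (hq : q.totalDegree ≤ k) {m : σ →₀ ℕ} (hm : m ∈ q.support) :
    m ≤ Finsupp.equivFunOnFinite.symm fun _ => k := fun i =>
  (MvPolynomial.monomial_le_degreeOf i hm).trans
    ((MvPolynomial.degreeOf_le_totalDegree q i).trans hq)

/-- The product rule for the `L²` inner product, on a family of piecewise polynomials of bounded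
degree. -/
theorem hasDerivWithinAt_l2Inner_self {k : ℕ} {u : ℝ → PwPoly d ι} {du : PwPoly d ι} {J : Set ℝ}
    {t : ℝ} (ht : t ∈ J) (hdeg : ∀ τ ∈ J, ∀ T j, (u τ T j).totalDegree ≤ k)
    (hu : HasTimeDerivWithinAt u du J t) :
    HasDerivWithinAt (fun τ => M.l2Inner (u τ) (u τ)) (2 * M.l2Inner du (u t)) J t := by
  classical
  -- The box of exponents at most `k` serves all times in `J`. No degree bound is known for `du`, so
  -- its supports are added.
  let s : Finset (Fin d →₀ ℕ) := Finset.Iic (Finsupp.equivFunOnFinite.symm fun _ => k) ∪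
    Finset.univ.biUnion fun T : ι => Finset.univ.biUnion fun j : Fin d => (du T j).support
  have hs : ∀ τ ∈ J, ∀ T j, (u τ T j).support ⊆ s := fun τ hτ T j m hm =>
    Finset.mem_union_left _ (Finset.mem_Iic.2
      (support_subset_Iic_of_totalDegree_le (hdeg τ hτ T j) hm))
  have hs' : ∀ T j, (du T j).support ⊆ s := fun T j m hm =>
    Finset.mem_union_right _ (Finset.mem_biUnion.2 ⟨T, Finset.mem_univ _,
      Finset.mem_biUnion.2 ⟨j, Finset.mem_univ _, hm⟩⟩)
  have heq : 2 * M.l2Inner du (u t) = M.l2Inner du (u t) + M.l2Inner (u t) du := by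
    rw [M.l2Inner_comm (u t), two_mul]
  have hsum : HasDerivWithinAt (fun τ => ∑ T, ∑ j, ∑ m ∈ s, ∑ m' ∈ s,
      (MvPolynomial.coeff m (u τ T j) * MvPolynomial.coeff m' (u τ T j)) *
        ∫ x in M.elem T, (∏ i, x i ^ m i) * ∏ i, x i ^ m' i)
      (2 * M.l2Inner du (u t)) J t := by
    rw [heq, M.l2Inner_eq_sum_coeff hs' (hs t ht), M.l2Inner_eq_sum_coeff (hs t ht) hs']
    simp only [← Finset.sum_add_distrib, ← add_mul]
    exact .fun_sum fun T _ => .fun_sum fun j _ => .fun_sum fun m _ => .fun_sum fun m' _ =>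
      ((hu T j m).fun_mul (hu T j m')).mul_const _
  exact hsum.congr (fun τ hτ => M.l2Inner_eq_sum_coeff (hs τ hτ) (hs τ hτ))
    (M.l2Inner_eq_sum_coeff (hs t ht) (hs t ht))

/-- The energy balance of the semi-discrete scheme. -/
theorem IsSemidiscreteSolution.hasDerivWithinAt_energy {M : PeriodicMesh d Ω ι} {k : ℕ} {J : Set ℝ}
    {u B : ℝ → PwPoly d ι} {minus : ℝ → ι × Fin (d + 1) → Space d → Prop}
    (h : M.IsSemidiscreteSolution k J u B minus) {t : ℝ} (ht : t ∈ J) :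
    HasDerivWithinAt (fun τ => M.l2Inner (u τ) (u τ) + M.l2Inner (B τ) (B τ))
      (-M.dissipation (minus t) (u t) (B t)) J t := by
  obtain ⟨hu, hB, hm, hties, du, dB, hdu, hdB, hequ, heqB⟩ := h t ht
  have h1 := M.hasDerivWithinAt_l2Inner_self ht (fun τ hτ => (h τ hτ).1.1) hdu
  have h2 := M.hasDerivWithinAt_l2Inner_self ht (fun τ hτ => (h τ hτ).2.1.1) hdB
  refine (h1.fun_add h2).congr_deriv ?_
  rw [dissipation_eq hu hB hm hties]
  -- The equations tested with `v = u t` and `φ = B t`.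
  linarith [hequ _ hu, heqB _ hB]

end PeriodicMesh

end

theorem mainTheorem1 {d : ℕ} [NeZero d] (hd : d = 2 ∨ d = 3) (Ω : Set (Space d)) (hΩ : IsOpen Ω)
    {ι : Type*} [Fintype ι] (M : PeriodicMesh d Ω ι) (k : ℕ) (hk : 1 ≤ k) :
    (∀ u ∈ M.divFreeSpace k, ∀ B ∈ M.divFreeSpace k,
      ∀ minus : ι × Fin (d + 1) → Space d → Prop, M.IsOutflowLabelling u minus →
        (M.formUU minus u u =
            1 / 2 * M.sumFacets (fun h x => |M.normalComp u h x| * ‖M.jump minus u h x‖ ^ 2) ∧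
          0 ≤ M.formUU minus u u) ∧
        (M.formUB minus u B B =
            1 / 2 * M.sumFacets (fun h x => |M.normalComp u h x| * ‖M.jump minus B h x‖ ^ 2) ∧
          0 ≤ M.formUB minus u B B) ∧
        (M.ResolvesTies u B minus →
          M.formBB minus u B u + M.formBU minus u B B =
            -(1 / 2) * M.sumFacets (fun h x => |M.normalComp B h x| *
              (‖M.jump minus u h x‖ ^ 2 + ‖M.jump minus B h x‖ ^ 2)) ∧
          M.formBB minus u B u + M.formBU minus u B B ≤ 0)) ∧
    (∀ (J : Set ℝ), J.OrdConnected → ∀ (u B : ℝ → PwPoly d ι)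
      (minus : ℝ → ι × Fin (d + 1) → Space d → Prop),
      M.IsSemidiscreteSolution k J u B minus →
        (∀ t ∈ J,
          HasDerivWithinAt (fun τ => M.l2Inner (u τ) (u τ) + M.l2Inner (B τ) (B τ))
            (-M.dissipation (minus t) (u t) (B t)) J t ∧
          -M.dissipation (minus t) (u t) (B t) ≤ 0) ∧
        AntitoneOn (fun τ => M.l2Inner (u τ) (u τ) + M.l2Inner (B τ) (B τ)) J) := by
  refine ⟨fun u hu B hB minus hm => ⟨⟨PeriodicMesh.formUU_self hu hm, ?_⟩,
    ⟨PeriodicMesh.formUB_self hu hm B, ?_⟩, fun ht =>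
      ⟨PeriodicMesh.formBB_add_formBU hu hB hm ht, ?_⟩⟩, fun J hJ u B minus h => ⟨fun t ht =>
        ⟨h.hasDerivWithinAt_energy ht, neg_nonpos.2 (PeriodicMesh.dissipation_nonneg _ _ _)⟩, ?_⟩⟩
  · rw [PeriodicMesh.formUU_self hu hm]
    exact mul_nonneg (by norm_num) (M.sumFacets_nonneg fun _ _ => by positivity)
  · rw [PeriodicMesh.formUB_self hu hm]
    exact mul_nonneg (by norm_num) (M.sumFacets_nonneg fun _ _ => by positivity)
  · rw [PeriodicMesh.formBB_add_formBU hu hB hm ht]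
    exact mul_nonpos_of_nonpos_of_nonneg (by norm_num)
      (M.sumFacets_nonneg fun _ _ => by positivity)
  · exact antitoneOn_of_hasDerivWithinAt_nonpos hJ.convex
      (fun t ht => (h.hasDerivWithinAt_energy ht).continuousWithinAt)
      (fun t ht => (h.hasDerivWithinAt_energy (interior_subset ht)).mono interior_subset)
      (fun t _ => neg_nonpos.2 (PeriodicMesh.dissipation_nonneg _ _ _))
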